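/- Consider the $(1+\varepsilon)$-approximate dynamic Hamming distance problem: maintain a text $T$ of length $n$ and a pattern $P$ of length $m$, $1\le m\le n$, over an alphabet $\{0,\dots,q-1\}$ of constant size $q$. An update $(j,a)$ replaces the letter at position $j$ of one of the strings by $a$. A query $i$ must return an integer $A$ with $d\le A\le(1+\varepsilon)d$, where $d$ is the current Hamming distance between $P$ and the length-$m$ substring of $T$ that starts at position $i$. The parameter satisfies $0<\varepsilon\le 1$. The model is a unit-cost word RAM with $w$-bit words, for every $w\ge c\log(n/\varepsilon)$ (precisely, $w\ge c(\lfloor\log_2(n\lceil 1/\varepsilon\rceil)\rfloor+1)$), which can draw independent uniformly random words. A data structure consists of a preprocessing, an update and a query program; these do not depend on $n$, $m$, $\varepsilon$, $w$, and receive $n$, $m$, $\lceil 1/\varepsilon\rceil$ and the initial strings as input. Preprocessing always halts. Time bounds are worst case per operation, for every outcome of the random words; space is counted in words and also covers the preprocessing. For every constant alphabet size $q$ and every constant $\delta\in(0,1)$ the following hold; the programs, the constant $c$ and the constants in $O(\cdot)$ depend on $q$ and $\delta$ only. (a) If only updates to the pattern are allowed, there is a randomised data structure with update time $O(1/\varepsilon)$,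 query time $O(1/\varepsilon^2)$ and space $O(n/\varepsilon^2)$. (b) If only updates to the text are allowed, there is a randomised data structure with update time $O(\varepsilon^{-1}(1+\log n)^e)$, query time $O(\varepsilon^{-2}(1+\log n)^e)$ and space $O(\varepsilon^{-2}\,n\,(1+\log n)^e)$, where $e$ is an absolute constant. In both cases, for every choice of initial strings and every sequence of allowed updates and queries that is fixed independently of the random words, each query is answered correctly with probability at least $1-\delta$. -/

import Mathlib

open MeasureTheory

namespace WordRAM

/-! A randomised word RAM with `w`-bit words.  Programs are structured (sequence, conditional,
loop); every elementary instruction and every test of a condition costs one time step. -/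

/-- The unit-cost operations on `w`-bit words. -/
inductive BinOp
  | add | sub | mul | div | mod | and | or | xor | shl | shr | lt | eq

/-- Arithmetic is modulo `2 ^ w`; comparisons return `0` or `1`. -/
def BinOp.eval (w : ℕ) : BinOp → ℕ → ℕ → ℕ
  | .add, a, b => (a + b) % 2 ^ w
  | .sub, a, b => (a + (2 ^ w - b)) % 2 ^ w
  | .mul, a, b => (a * b) % 2 ^ w
  | .div, a, b => a / b
  | .mod, a, b => a % b
  | .and, a, b => a &&& b
  | .or, a, b => a ||| b
  | .xor, a, b => a ^^^ b
  | .shl, a, b => (a * 2 ^ b) % 2 ^ w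
  | .shr, a, b => a / 2 ^ b
  | .lt, a, b => if a < b then 1 else 0
  | .eq, a, b => if a = b then 1 else 0

/-- An operand is a register or a constant of the program. -/
inductive Operand
  | reg (r : ℕ)
  | const (v : ℕ)

/-- Word RAM programs. A program is a finite object, so it names only finitely many registers. -/
inductive Prog
  | skip
  /-- `dst := x o y` on registers -/
  | op (o : BinOp) (dst : ℕ) (x y : Operand)
  /-- `dst := memory[addr]` -/
  | load (dst : ℕ) (addr : Operand)
  /-- `memory[addr] := x` -/
  | store (addr x : Operand)
  /-- `dst :=` a fresh uniformly random word -/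
  | rand (dst : ℕ)
  | seq (p q : Prog)
  /-- if `x ≠ 0` then `p` else `q` -/
  | ifNZ (x : Operand) (p q : Prog)
  /-- while `x ≠ 0` do `p` -/
  | whileNZ (x : Operand) (p : Prog)

/-- A configuration: registers, memory words, and the number of random words drawn so far. -/
structure Config where
  reg : ℕ → ℕ
  mem : ℕ → ℕ
  drawn : ℕ

def Config.setReg (s : Config) (r v : ℕ) : Config :=
  { s with reg := Function.update s.reg r v }

def Config.setMem (s : Config) (a v : ℕ) : Config :=
  { s with mem := Function.update s.mem a v }

def Operand.val (w : ℕ) (s : Config) : Operand → ℕ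
  | .reg r => s.reg r
  | .const v => v % 2 ^ w

/-- `Exec w S ω p s t s'`: with word size `w` and random words `ω 0, ω 1, …`, the program `p`
started in configuration `s` halts after exactly `t` steps in configuration `s'`, and all memory
words that it reads or writes have addresses `< S`. -/
inductive Exec (w S : ℕ) (ω : ℕ → Fin (2 ^ w)) : Prog → Config → ℕ → Config → Prop
  | skip (s : Config) : Exec w S ω .skip s 1 s
  | op (s : Config) (o : BinOp) (dst : ℕ) (x y : Operand) :
      Exec w S ω (.op o dst x y) s 1 (s.setReg dst (o.eval w (x.val w s) (y.val w s)))
  | load (s : Config) (dst : ℕ) (a : Operand) (ha : a.val w s < S) :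
      Exec w S ω (.load dst a) s 1 (s.setReg dst (s.mem (a.val w s)))
  | store (s : Config) (a x : Operand) (ha : a.val w s < S) :
      Exec w S ω (.store a x) s 1 (s.setMem (a.val w s) (x.val w s))
  | rand (s : Config) (dst : ℕ) :
      Exec w S ω (.rand dst) s 1
        { s.setReg dst (ω s.drawn : ℕ) with drawn := s.drawn + 1 }
  | seq {p q : Prog} {s s₁ s₂ : Config} {t₁ t₂ : ℕ}
      (h₁ : Exec w S ω p s t₁ s₁) (h₂ : Exec w S ω q s₁ t₂ s₂) :
      Exec w S ω (.seq p q) s (t₁ + t₂) s₂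
  | ifTrue {x : Operand} {p q : Prog} {s s' : Config} {t : ℕ}
      (hx : x.val w s ≠ 0) (h : Exec w S ω p s t s') :
      Exec w S ω (.ifNZ x p q) s (t + 1) s'
  | ifFalse {x : Operand} {p q : Prog} {s s' : Config} {t : ℕ}
      (hx : x.val w s = 0) (h : Exec w S ω q s t s') :
      Exec w S ω (.ifNZ x p q) s (t + 1) s'
  | whileDone {x : Operand} {p : Prog} {s : Config} (hx : x.val w s = 0) :
      Exec w S ω (.whileNZ x p) s 1 s
  | whileStep {x : Operand} {p : Prog} {s s₁ s₂ : Config} {t₁ t₂ : ℕ}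
      (hx : x.val w s ≠ 0) (h₁ : Exec w S ω p s t₁ s₁)
      (h₂ : Exec w S ω (.whileNZ x p) s₁ t₂ s₂) :
      Exec w S ω (.whileNZ x p) s (t₁ + t₂ + 1) s₂

/-- Execution is deterministic once the random words are fixed. -/
theorem Exec.det {w S : ℕ} {ω : ℕ → Fin (2 ^ w)} {p : Prog} {s s₁ : Config} {t₁ : ℕ}
    (h : Exec w S ω p s t₁ s₁) :
    ∀ {s₂ : Config} {t₂ : ℕ}, Exec w S ω p s t₂ s₂ → t₁ = t₂ ∧ s₁ = s₂ := by
  induction h with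
  | skip | op | load | store | rand => intro s₂ t₂ h'; cases h'; exact ⟨rfl, rfl⟩
  | seq _ _ ih₁ ih₂ =>
    intro s₂ t₂ h'
    cases h' with
    | seq a b =>
      obtain ⟨rfl, rfl⟩ := ih₁ a
      obtain ⟨rfl, rfl⟩ := ih₂ b
      exact ⟨rfl, rfl⟩
  | ifTrue hx _ ih =>
    intro s₂ t₂ h'
    cases h' with
    | ifTrue _ a => obtain ⟨rfl, rfl⟩ := ih a; exact ⟨rfl, rfl⟩
    | ifFalse hx' _ => exact absurd hx' hx
  | ifFalse hx _ ih =>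
    intro s₂ t₂ h'
    cases h' with
    | ifTrue hx' _ => exact absurd hx hx'
    | ifFalse _ a => obtain ⟨rfl, rfl⟩ := ih a; exact ⟨rfl, rfl⟩
  | whileDone hx =>
    intro s₂ t₂ h'
    cases h' with
    | whileDone => exact ⟨rfl, rfl⟩
    | whileStep hx' _ _ => exact absurd hx hx'
  | whileStep hx _ _ ih₁ ih₂ =>
    intro s₂ t₂ h'
    cases h' with
    | whileDone hx' => exact absurd hx' hx
    | whileStep _ a b =>
      obtain ⟨rfl, rfl⟩ := ih₁ a
      obtain ⟨rfl, rfl⟩ := ih₂ b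
      exact ⟨rfl, rfl⟩

/-- The law of an infinite sequence of independent uniformly random `w`-bit words. -/
noncomputable def randomWords (w : ℕ) : Measure (ℕ → Fin (2 ^ w)) :=
  Measure.infinitePi fun _ => (PMF.uniformOfFintype (Fin (2 ^ w))).toMeasure

end WordRAM

namespace DynApproxHD

open WordRAM

/-- A pattern of length `m` and a text of length `n` over the alphabet `{0, …, q - 1}`. -/
structure Strings (q n m : ℕ) where
  pattern : Fin m → Fin q
  text : Fin n → Fin q

/-- The Hamming distance between the pattern and the length-`m` substring of the text that starts
at the (zero-based) position `i`. -/
def Strings.dist {q n m : ℕ} (x : Strings q n m) (i : ℕ) (hi : i + m ≤ n) : ℕ :=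
  hammingDist x.pattern fun j : Fin m => x.text ⟨i + j, by omega⟩

/-- Which of the two strings may be updated. -/
inductive Mode
  | patternOnly
  | textOnly

/-- The length of the string that may be updated. -/
def Mode.len (n m : ℕ) : Mode → ℕ
  | .patternOnly => m
  | .textOnly => n

/-- An operation: replace the letter at one position of the updatable string, or query an
alignment. -/
inductive Op (M : Mode) (q n m : ℕ)
  | update (j : Fin (M.len n m)) (a : Fin q)
  | query (i : ℕ) (hi : i + m ≤ n)

/-- The effect of an update on the strings. -/
def Strings.update {q n m : ℕ} (x : Strings q n m) :
    (M : Mode) → Fin (M.len n m) → Fin q → Strings q n m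
  | .patternOnly, j, a => { x with pattern := Function.update x.pattern j a }
  | .textOnly, j, a => { x with text := Function.update x.text j a }

/-- The effect of an operation on the strings. -/
def Op.apply {M : Mode} {q n m : ℕ} (x : Strings q n m) : Op M q n m → Strings q n m
  | .update j a => x.update M j a
  | .query _ _ => x

/-- The strings after a sequence of operations. -/
def Strings.after {M : Mode} {q n m : ℕ} (x : Strings q n m) (ops : List (Op M q n m)) :
    Strings q n m :=
  ops.foldl Op.apply x

/-- A randomised dynamic data structure: three word RAM programs sharing registers and memory. -/
structure DataStructure where
  preprocess : Prog
  update : Prog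
  query : Prog

/-- The initial configuration: `n`, `m`, `K` in registers `0`, `1`, `2`; the pattern followed by
the text in memory words `0, …, m + n - 1`; zero elsewhere. -/
def startConfig {q n m : ℕ} (x : Strings q n m) (K : ℕ) : Config where
  reg r := if r = 0 then n else if r = 1 then m else if r = 2 then K else 0
  mem a :=
    if h : a < m then (x.pattern ⟨a, h⟩ : ℕ)
    else if h : a - m < n then (x.text ⟨a - m, h⟩ : ℕ)
    else 0
  drawn := 0

/-- The program run for an operation. -/
def Op.prog {M : Mode} {q n m : ℕ} (D : DataStructure) : Op M q n m → Prog
  | .update _ _ => D.update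
  | .query _ _ => D.query

/-- The arguments of an operation are passed in registers `0` and `1`; nothing else changes. -/
def Op.call {M : Mode} {q n m : ℕ} (s : Config) : Op M q n m → Config
  | .update j a => (s.setReg 0 (j : ℕ)).setReg 1 (a : ℕ)
  | .query i _ => s.setReg 0 i

/-- `Reach w S ω D K x ops s`: on input strings `x` and accuracy parameter `K`, the data structure
`D` is in configuration `s` after preprocessing and then serving the operations `ops` in order,
never touching a memory word with address `≥ S`. -/
inductive Reach (w S : ℕ) (ω : ℕ → Fin (2 ^ w)) (D : DataStructure) {M : Mode} {q n m : ℕ}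
    (K : ℕ) (x : Strings q n m) : List (Op M q n m) → Config → Prop
  | start {s : Config} {t : ℕ} (h : Exec w S ω D.preprocess (startConfig x K) t s) :
      Reach w S ω D K x [] s
  | step {ops : List (Op M q n m)} {s s' : Config} {t : ℕ} (o : Op M q n m)
      (h : Reach w S ω D K x ops s) (h' : Exec w S ω (o.prog D) (o.call s) t s') :
      Reach w S ω D K x (ops ++ [o]) s'

/-- The time allowed for an operation. -/
def Op.bound {M : Mode} {q n m : ℕ} (tu tq : ℝ) : Op M q n m → ℝ
  | .update _ _ => tu
  | .query _ _ => tq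

/-- `A` is a `(1 + ε)`-approximation of `d`. -/
def IsApprox (ε : ℝ) (d A : ℕ) : Prop :=
  (d : ℝ) ≤ A ∧ (A : ℝ) ≤ (1 + ε) * d

/-- On a word RAM with word size `w`, the data structure `D`, given `n`, `m` and `⌈1 / ε⌉`, solves
the `(1 + ε)`-approximate dynamic Hamming distance problem with updates restricted to the mode `M`,
for a text of length `n` and a pattern of length `m` over an alphabet of size `q`, in worst case
update time `tu`, worst case query time `tq` and space `sp` (in words), each answer being correct
with probability at least `1 - δ`. -/
structure Solves (D : DataStructure) (M : Mode) (q n m w : ℕ) (ε δ tu tq sp : ℝ) : Prop where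
  /-- Preprocessing halts, within the allowed space, for every outcome of the random words. -/
  preprocess_halts : ∀ (x : Strings q n m) (ω : ℕ → Fin (2 ^ w)),
    ∃ t s, Exec w ⌊sp⌋₊ ω D.preprocess (startConfig x ⌈1 / ε⌉₊) t s
  /-- After any sequence of operations, and for every outcome of the random words, each operation
  halts within its time bound and within the allowed space. -/
  time_le : ∀ (x : Strings q n m) (ω : ℕ → Fin (2 ^ w)) (ops : List (Op M q n m)) (s : Config)
    (o : Op M q n m), Reach w ⌊sp⌋₊ ω D ⌈1 / ε⌉₊ x ops s →
      ∃ (t : ℕ) (s' : Config),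
        Exec w ⌊sp⌋₊ ω (o.prog D) (o.call s) t s' ∧ (t : ℝ) ≤ o.bound tu tq
  /-- For every fixed sequence of operations followed by a query, the probability that the query
  is not answered (in register `0`) by a `(1 + ε)`-approximation of the current Hamming distance
  is at most `δ`. -/
  error_le : ∀ (x : Strings q n m) (ops : List (Op M q n m)) (i : ℕ) (hi : i + m ≤ n),
    randomWords w {ω | ¬ ∃ s, Reach w ⌊sp⌋₊ ω D ⌈1 / ε⌉₊ x (ops ++ [Op.query i hi]) s ∧
        IsApprox ε ((x.after ops).dist i hi) (s.reg 0)} ≤ ENNReal.ofReal δ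

end DynApproxHD

/-!
The data structure keeps CountSketches of the two strings. Every position of the updatable string
draws one random word; its lowest bit is a sign and the remaining bits, modulo `k`, are a bucket.
A letter `a` at that position contributes its sign to coordinate `a * k + bucket`, so a sketch has
`L = q * k` coordinates, and changing one letter changes two coordinates by one unit each. Both
strings are hashed by the position in the updatable string (under alignment `i`, letter `j` of the
pattern is paired with letter `i + j` of the text); the sketch of the fixed string then depends on
the alignment only, never on the updates, and is precomputed for every alignment.

For a pattern that is updated, its single sketch is stored, and an update costs `O(1)`. For a text
that is updated, the sketch of a window is a sum over an interval of positions: the sketches of the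
single positions are the leaves of a segment tree, of which an update changes two coordinates along
a path from a leaf to the root (`runs_addDyn`), and a query sums `O(log n)` nodes per coordinate
(`sum_Ico_tree`, `runs_readDyn`).

The estimator is the squared distance `Z` of the two sketches. Its diagonal terms add up to exactly
`2 d`, because a mismatch contributes the squared norm of a difference of two unit vectors
(`sketchDist_eq`). The off-diagonal terms carry a product of two distinct signs and a collision of
two buckets; flipping a sign shows that they are uncorrelated, and two buckets collide with
probability at most `2 / k`, so the variance is `O(d ^ 2 / k)`. With `k = C₀ * K ^ 2` and
`K = ⌈1 / ε⌉` Chebyshev's inequality gives relative error `1 / (3 K)` with probability at least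
`1 - 72 / C₀` (`randomWords_sketchDist_le`), and `⌊3 K Z / (2 (3 K - 1))⌋` is then an integer
between `d` and `(1 + ε) d` (`isApprox_of_estimate`).

All sketch arithmetic is done modulo `2 ^ w`. The programs compute the image of `Z` in
`ZMod (2 ^ w)`, and since `0 ≤ Z < 2 ^ w` whenever the estimate is good, intermediate overflows do
not matter.
-/

namespace WordRAM

/-! ### Total correctness of word RAM programs -/

infixr:60 " ;; " => Prog.seq

/-- Total correctness with a time bound: `p` started in `s` halts within `T` steps in a
configuration satisfying `Q`. -/
def Runs (w S : ℕ) (ω : ℕ → Fin (2 ^ w)) (p : Prog) (s : Config) (T : ℕ) (Q : Config → Prop) :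
    Prop :=
  ∃ t s', Exec w S ω p s t s' ∧ t ≤ T ∧ Q s'

/-- Total correctness without a time bound. -/
def Halts (w S : ℕ) (ω : ℕ → Fin (2 ^ w)) (p : Prog) (s : Config) (Q : Config → Prop) : Prop :=
  ∃ t s', Exec w S ω p s t s' ∧ Q s'

section Rules

variable {w S : ℕ} {ω : ℕ → Fin (2 ^ w)} {p q : Prog} {s : Config} {T T₁ T₂ : ℕ}
  {Q Q' : Config → Prop}

@[simp] theorem Config.setReg_reg (s : Config) (r v r' : ℕ) :
    (s.setReg r v).reg r' = if r' = r then v else s.reg r' := by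
  simp [Config.setReg, Function.update_apply]

@[simp] theorem Config.setReg_mem (s : Config) (r v : ℕ) : (s.setReg r v).mem = s.mem := rfl

@[simp] theorem Config.setReg_drawn (s : Config) (r v : ℕ) : (s.setReg r v).drawn = s.drawn := rfl

@[simp] theorem Config.setMem_reg (s : Config) (a v : ℕ) : (s.setMem a v).reg = s.reg := rfl

@[simp] theorem Config.setMem_mem (s : Config) (a v : ℕ) :
    (s.setMem a v).mem = Function.update s.mem a v := rfl

@[simp] theorem Config.setMem_drawn (s : Config) (a v : ℕ) : (s.setMem a v).drawn = s.drawn := rfl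

@[simp] theorem Operand.val_reg (w : ℕ) (s : Config) (r : ℕ) :
    (Operand.reg r).val w s = s.reg r := rfl

@[simp] theorem Operand.val_const (w : ℕ) (s : Config) (v : ℕ) :
    (Operand.const v).val w s = v % 2 ^ w := rfl

theorem Runs.mono (h : Runs w S ω p s T₁ Q) (hT : T₁ ≤ T₂) (hQ : ∀ s', Q s' → Q' s') :
    Runs w S ω p s T₂ Q' := by
  obtain ⟨t, s', h, ht, hq⟩ := h
  exact ⟨t, s', h, ht.trans hT, hQ _ hq⟩

theorem Runs.halts (h : Runs w S ω p s T Q) : Halts w S ω p s Q := by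
  obtain ⟨t, s', h, _, hq⟩ := h
  exact ⟨t, s', h, hq⟩

theorem Halts.mono (h : Halts w S ω p s Q) (hQ : ∀ s', Q s' → Q' s') :
    Halts w S ω p s Q' := by
  obtain ⟨t, s', h, hq⟩ := h
  exact ⟨t, s', h, hQ _ hq⟩

theorem Runs.seq (h₁ : Runs w S ω p s T₁ Q') (h₂ : ∀ s', Q' s' → Runs w S ω q s' T₂ Q) :
    Runs w S ω (p ;; q) s (T₁ + T₂) Q := by
  obtain ⟨t, s', h, ht, hq⟩ := h₁
  obtain ⟨t', s'', h', ht', hq'⟩ := h₂ s' hq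
  exact ⟨_, _, .seq h h', by omega, hq'⟩

theorem Halts.seq (h₁ : Halts w S ω p s Q') (h₂ : ∀ s', Q' s' → Halts w S ω q s' Q) :
    Halts w S ω (p ;; q) s Q := by
  obtain ⟨t, s', h, hq⟩ := h₁
  obtain ⟨t', s'', h', hq'⟩ := h₂ s' hq
  exact ⟨_, _, .seq h h', hq'⟩

theorem Runs.op {o : BinOp} {d : ℕ} {x y : Operand}
    (h : Q (s.setReg d (o.eval w (x.val w s) (y.val w s)))) :
    Runs w S ω (.op o d x y) s 1 Q :=
  ⟨1, _, .op .., le_rfl, h⟩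

theorem Runs.load {d : ℕ} {a : Operand} (ha : a.val w s < S)
    (h : Q (s.setReg d (s.mem (a.val w s)))) : Runs w S ω (.load d a) s 1 Q :=
  ⟨1, _, .load _ _ _ ha, le_rfl, h⟩

theorem Runs.store {a x : Operand} (ha : a.val w s < S)
    (h : Q (s.setMem (a.val w s) (x.val w s))) : Runs w S ω (.store a x) s 1 Q :=
  ⟨1, _, .store _ _ _ ha, le_rfl, h⟩

theorem Runs.op_seq {o : BinOp} {d : ℕ} {x y : Operand}
    (h : Runs w S ω q (s.setReg d (o.eval w (x.val w s) (y.val w s))) T Q) :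
    Runs w S ω (.op o d x y ;; q) s (1 + T) Q :=
  Runs.seq (Q' := fun s' => s' = s.setReg d (o.eval w (x.val w s) (y.val w s)))
    (Runs.op rfl) (by rintro _ rfl; exact h)

theorem Halts.op_seq {o : BinOp} {d : ℕ} {x y : Operand}
    (h : Halts w S ω q (s.setReg d (o.eval w (x.val w s) (y.val w s))) Q) :
    Halts w S ω (.op o d x y ;; q) s Q :=
  Halts.seq (Q' := fun s' => s' = s.setReg d (o.eval w (x.val w s) (y.val w s)))
    ⟨1, _, .op .., rfl⟩ (by rintro _ rfl; exact h)

theorem Runs.load_seq {d : ℕ} {a : Operand} (ha : a.val w s < S)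
    (h : Runs w S ω q (s.setReg d (s.mem (a.val w s))) T Q) :
    Runs w S ω (.load d a ;; q) s (1 + T) Q :=
  Runs.seq (Q' := fun s' => s' = s.setReg d (s.mem (a.val w s)))
    (Runs.load ha rfl) (by rintro _ rfl; exact h)

theorem Runs.store_seq {a x : Operand} (ha : a.val w s < S)
    (h : Runs w S ω q (s.setMem (a.val w s) (x.val w s)) T Q) :
    Runs w S ω (.store a x ;; q) s (1 + T) Q :=
  Runs.seq (Q' := fun s' => s' = s.setMem (a.val w s) (x.val w s))
    (Runs.store ha rfl) (by rintro _ rfl; exact h)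

theorem Runs.rand_seq {d : ℕ}
    (h : Runs w S ω q { s.setReg d (ω s.drawn : ℕ) with drawn := s.drawn + 1 } T Q) :
    Runs w S ω (.rand d ;; q) s (1 + T) Q :=
  Runs.seq (Q' := fun s' => s' = { s.setReg d (ω s.drawn : ℕ) with drawn := s.drawn + 1 })
    ⟨1, _, .rand .., le_rfl, rfl⟩ (by rintro _ rfl; exact h)

/-- The loop rule. The invariant `I` is indexed by a bound on the number of iterations to come. -/
theorem Runs.while {x : Operand} (I : ℕ → Config → Prop)
    (hstep : ∀ f s, I f s → x.val w s ≠ 0 → ∃ g, f = g + 1 ∧ Runs w S ω p s T (I g)) (f : ℕ) :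
    ∀ s, I f s → Runs w S ω (.whileNZ x p) s (f * (T + 1) + 1)
      (fun s' => x.val w s' = 0 ∧ ∃ g, I g s') := by
  induction f with
  | zero =>
    intro s hI
    by_cases hx : x.val w s = 0
    · exact ⟨1, s, .whileDone hx, by omega, hx, 0, hI⟩
    · obtain ⟨g, hg, -⟩ := hstep 0 s hI hx
      omega
  | succ f ih =>
    intro s hI
    by_cases hx : x.val w s = 0
    · exact ⟨1, s, .whileDone hx, by omega, hx, _, hI⟩
    · obtain ⟨g, hg, t, s', h, ht, hq⟩ := hstep _ s hI hx
      obtain rfl : f = g := by omega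
      obtain ⟨t', s'', h', ht', hq'⟩ := ih s' hq
      exact ⟨_, _, .whileStep hx h h', by ring_nf at ht' ⊢; omega, hq'⟩

/-- `for i := 0, 1, …, b - 1 do p`, where `flag` is an auxiliary register. -/
def forLoop (i flag : ℕ) (b : Operand) (p : Prog) : Prog :=
  .op .add i (.const 0) (.const 0) ;; .op .lt flag (.reg i) b ;;
    .whileNZ (.reg flag) (p ;; .op .add i (.reg i) (.const 1) ;; .op .lt flag (.reg i) b)

theorem Halts.while {x : Operand} (I : ℕ → Config → Prop)
    (hstep : ∀ f s, I f s → x.val w s ≠ 0 → ∃ g, f = g + 1 ∧ Halts w S ω p s (I g)) (f : ℕ) :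
    ∀ s, I f s → Halts w S ω (.whileNZ x p) s (fun s' => x.val w s' = 0 ∧ ∃ g, I g s') := by
  induction f with
  | zero =>
    intro s hI
    by_cases hx : x.val w s = 0
    · exact ⟨1, s, .whileDone hx, hx, 0, hI⟩
    · obtain ⟨g, hg, -⟩ := hstep 0 s hI hx
      omega
  | succ f ih =>
    intro s hI
    by_cases hx : x.val w s = 0
    · exact ⟨1, s, .whileDone hx, hx, _, hI⟩
    · obtain ⟨g, hg, t, s', h, hq⟩ := hstep _ s hI hx
      obtain rfl : f = g := by omega
      obtain ⟨t', s'', h', hq'⟩ := ih s' hq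
      exact ⟨_, _, .whileStep hx h h', hq'⟩

/-- The rule for counting loops: the invariant must not depend on the two loop registers. -/
theorem Halts.forLoop {i flag b N : ℕ} (hif : i ≠ flag) (hbi : b ≠ i) (hbf : b ≠ flag)
    (hN : N < 2 ^ w) (I : ℕ → Config → Prop)
    (hi : ∀ t s v, I t s → I t (s.setReg i v)) (hf : ∀ t s v, I t s → I t (s.setReg flag v))
    (hb : s.reg b = N) (h0 : I 0 s)
    (hstep : ∀ t s, t < N → s.reg b = N → s.reg i = t → I t s →
      Halts w S ω p s (fun s' => s'.reg b = N ∧ s'.reg i = t ∧ I (t + 1) s')) :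
    Halts w S ω (forLoop i flag (.reg b) p) s (I N) := by
  -- Each evaluation of the loop test leaves the invariant and the counter untouched.
  have key : ∀ s', s'.reg b = N → s'.reg i ≤ N → I (s'.reg i) s' →
      Halts w S ω (.op .lt flag (.reg i) (.reg b)) s' (fun s'' => s''.reg b = N ∧
        s''.reg i = s'.reg i ∧ I (s'.reg i) s'' ∧
        s''.reg flag = if s'.reg i < N then 1 else 0) := by
    intro s' h1 h2 h3
    refine (Runs.op ?_).halts
    simp only [Config.setReg_reg, Operand.val_reg, BinOp.eval, h1, if_neg hbf, if_neg hif, if_true,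
      true_and, and_true]
    exact hf _ _ _ h3
  let J : ℕ → Config → Prop := fun f s' => s'.reg b = N ∧ s'.reg i + f = N ∧ I (s'.reg i) s' ∧
    s'.reg flag = if s'.reg i < N then 1 else 0
  refine Halts.seq (Q' := fun s' => s'.reg b = N ∧ s'.reg i = 0 ∧ I 0 s') ?_ ?_
  · refine (Runs.op ?_).halts
    simp only [Config.setReg_reg, if_neg hbi, hb, true_and, BinOp.eval, Operand.val_const, if_true]
    refine ⟨by simp, hi _ _ _ h0⟩
  rintro s₁ ⟨h1, h2, h3⟩
  refine Halts.seq (Q' := J N) ?_ ?_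
  · refine (key s₁ h1 (by omega) (by rw [h2]; exact h3)).mono ?_
    rintro s₂ ⟨a, b, c, d⟩
    refine ⟨a, by omega, by rw [b]; exact c, by rw [b]; exact d⟩
  intro s₂ hJ
  refine (Halts.while J ?_ N s₂ hJ).mono ?_
  · rintro f s₃ ⟨a, e, c, d⟩ hx
    rw [Operand.val_reg, d] at hx
    have hlt : s₃.reg i < N := by by_contra hh; simp [hh] at hx
    refine ⟨f - 1, by omega, Halts.seq (hstep _ s₃ hlt a rfl c) ?_⟩
    rintro s₄ ⟨a4, e4, c4⟩
    refine Halts.seq (Q' := fun s' => s'.reg b = N ∧ s'.reg i = s₃.reg i + 1 ∧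
      I (s₃.reg i + 1) s') ?_ ?_
    · refine (Runs.op ?_).halts
      simp only [Config.setReg_reg, if_neg hbi, a4, true_and, BinOp.eval, Operand.val_const,
        Operand.val_reg, if_true]
      refine ⟨?_, hi _ _ _ c4⟩
      rw [e4, Nat.mod_eq_of_lt (show 1 < 2 ^ w by omega), Nat.mod_eq_of_lt (by omega)]
    rintro s₅ ⟨a5, e5, c5⟩
    refine (key s₅ a5 (by omega) (by rw [e5]; exact c5)).mono ?_
    rintro s₂ ⟨a6, b6, c6, d6⟩
    refine ⟨a6, by omega, by rw [b6]; exact c6, by rw [b6]; exact d6⟩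
  · rintro s₃ ⟨hx, g, a, e, c, d⟩
    rw [Operand.val_reg, d] at hx
    have hlt : ¬ s₃.reg i < N := by intro hh; simp [hh] at hx
    have : s₃.reg i = N := by omega
    rw [this] at c
    exact c

end Rules

/-! ### Random words: signs, buckets and collisions -/

/-- The sign encoded by the lowest bit of a random word. -/
def wordSign (v : ℕ) : ℤ := 1 - 2 * ((v % 2 : ℕ) : ℤ)

/-- The bucket, out of `k`, encoded by the remaining bits of a random word. -/
def wordBucket (k v : ℕ) : ℕ := v / 2 % k

theorem wordSign_mul_self (v : ℕ) : wordSign v * wordSign v = 1 := by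
  rcases Nat.mod_two_eq_zero_or_one v with h | h <;> simp [wordSign, h]

/-- Flipping the lowest bit of a word. -/
def flipLow (w : ℕ) (v : Fin (2 ^ w)) : Fin (2 ^ w) :=
  if h : (v : ℕ) % 2 = 0 then
    if h' : (v : ℕ) + 1 < 2 ^ w then ⟨v + 1, h'⟩ else v
  else ⟨v - 1, by omega⟩

theorem two_dvd_two_pow {w : ℕ} (hw : 1 ≤ w) : 2 ∣ 2 ^ w := dvd_pow_self 2 (by omega)

theorem flipLow_val {w : ℕ} (hw : 1 ≤ w) (v : Fin (2 ^ w)) :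
    (flipLow w v : ℕ) = if (v : ℕ) % 2 = 0 then (v : ℕ) + 1 else v - 1 := by
  have h2 := two_dvd_two_pow hw
  have := v.2
  unfold flipLow
  split_ifs with h h'
  · rfl
  · omega
  · rfl

theorem flipLow_involutive {w : ℕ} (hw : 1 ≤ w) : Function.Involutive (flipLow w) := by
  intro v
  apply Fin.ext
  rw [flipLow_val hw, flipLow_val hw]
  split_ifs <;> omega

theorem wordSign_flipLow {w : ℕ} (hw : 1 ≤ w) (v : Fin (2 ^ w)) :
    wordSign (flipLow w v) = -wordSign v := by
  unfold wordSign
  rw [flipLow_val hw]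
  split_ifs <;> omega

theorem wordBucket_flipLow {w : ℕ} (hw : 1 ≤ w) (k : ℕ) (v : Fin (2 ^ w)) :
    wordBucket k (flipLow w v) = wordBucket k v := by
  unfold wordBucket
  rw [flipLow_val hw]
  congr 1
  split_ifs <;> omega

/-- The uniform distribution on `w`-bit words. -/
noncomputable abbrev uniformWord (w : ℕ) : Measure (Fin (2 ^ w)) :=
  (PMF.uniformOfFintype (Fin (2 ^ w))).toMeasure

instance (w : ℕ) : IsProbabilityMeasure (randomWords w) := by
  unfold randomWords; infer_instance

theorem uniformWord_singleton (w : ℕ) (v : Fin (2 ^ w)) :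
    uniformWord w {v} = ((2 : ENNReal) ^ w)⁻¹ := by
  rw [PMF.toMeasure_apply_singleton _ _ (measurableSet_singleton v)]
  simp

theorem uniformWord_map_flipLow {w : ℕ} (hw : 1 ≤ w) :
    (uniformWord w).map (flipLow w) = uniformWord w := by
  refine Measure.ext_of_singleton fun v => ?_
  rw [Measure.map_apply (measurable_of_finite _) (measurableSet_singleton v)]
  have : flipLow w ⁻¹' {v} = {flipLow w v} := by
    ext u
    simp only [Set.mem_preimage, Set.mem_singleton_iff]
    exact ⟨fun h => by rw [← h, flipLow_involutive hw], fun h => by rw [h, flipLow_involutive hw]⟩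
  rw [this, uniformWord_singleton, uniformWord_singleton]

/-- Flipping the lowest bit of the `a`-th random word. -/
def flipAt (w a : ℕ) (ω : ℕ → Fin (2 ^ w)) : ℕ → Fin (2 ^ w) :=
  fun i => (if i = a then flipLow w else id) (ω i)

theorem measurePreserving_flipAt {w : ℕ} (hw : 1 ≤ w) (a : ℕ) :
    MeasurePreserving (flipAt w a) (randomWords w) (randomWords w) := by
  have hm : ∀ i, Measurable (if i = a then flipLow w else id : Fin (2 ^ w) → Fin (2 ^ w)) :=
    fun i => measurable_of_finite _
  refine ⟨measurable_pi_lambda _ fun i => (hm i).comp (measurable_pi_apply i), ?_⟩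
  unfold randomWords flipAt
  rw [Measure.infinitePi_map_pi _ hm]
  congr 1
  funext i
  split_ifs
  · exact uniformWord_map_flipLow hw
  · exact Measure.map_id

/-- The product of the signs of the words `a` and `b` if the words fall into the same bucket. -/
def collision (k a b : ℕ) {w : ℕ} (ω : ℕ → Fin (2 ^ w)) : ℝ :=
  if wordBucket k (ω a) = wordBucket k (ω b) then (wordSign (ω a) : ℝ) * wordSign (ω b) else 0

theorem measurable_collision (k a b w : ℕ) :
    Measurable (collision k a b : (ℕ → Fin (2 ^ w)) → ℝ) := by
  let F : Fin (2 ^ w) × Fin (2 ^ w) → ℝ := fun z =>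
    if wordBucket k z.1 = wordBucket k z.2 then (wordSign z.1 : ℝ) * wordSign z.2 else 0
  have hF : Measurable F := measurable_of_finite F
  have hpair : Measurable fun ω : ℕ → Fin (2 ^ w) => (ω a, ω b) := by fun_prop
  exact hF.comp hpair

theorem abs_wordSign (v : ℕ) : |(wordSign v : ℝ)| = 1 := by
  rcases Nat.mod_two_eq_zero_or_one v with h | h <;> simp [wordSign, h]

theorem abs_collision_le (k a b : ℕ) {w : ℕ} (ω : ℕ → Fin (2 ^ w)) :
    |collision k a b ω| ≤ 1 := by
  unfold collision
  split_ifs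
  · rw [abs_mul, abs_wordSign, abs_wordSign]; norm_num
  · simp

theorem integrable_collision_mul (k a b a' b' w : ℕ) :
    Integrable (fun ω => collision k a b ω * collision k a' b' ω) (randomWords w) := by
  refine Integrable.of_bound
    ((measurable_collision k a b w).mul (measurable_collision k a' b' w)).aestronglyMeasurable 1
    (Filter.Eventually.of_forall fun ω => ?_)
  rw [Real.norm_eq_abs, abs_mul]
  exact mul_le_one₀ (abs_collision_le ..) (abs_nonneg _) (abs_collision_le ..)

theorem collision_flipAt_of_ne {k a b c w : ℕ} (ha : a ≠ c) (hb : b ≠ c) (ω : ℕ → Fin (2 ^ w)) :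
    collision k a b (flipAt w c ω) = collision k a b ω := by
  simp [collision, flipAt, ha, hb]

theorem collision_flipAt_left {k a b w : ℕ} (hw : 1 ≤ w) (hb : b ≠ a) (ω : ℕ → Fin (2 ^ w)) :
    collision k a b (flipAt w a ω) = -collision k a b ω := by
  simp only [collision, flipAt, if_true, if_neg hb, id, wordBucket_flipLow hw, wordSign_flipLow hw]
  split_ifs <;> simp

theorem collision_comm (k a b : ℕ) {w : ℕ} (ω : ℕ → Fin (2 ^ w)) :
    collision k a b ω = collision k b a ω := by
  unfold collision
  simp only [eq_comm (a := wordBucket k (ω a)), mul_comm]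

theorem collision_flipAt_right {k a b w : ℕ} (hw : 1 ≤ w) (hb : a ≠ b) (ω : ℕ → Fin (2 ^ w)) :
    collision k a b (flipAt w b ω) = -collision k a b ω := by
  rw [collision_comm, collision_flipAt_left hw hb, collision_comm]

theorem integral_eq_zero_of_flip {w : ℕ} (hw : 1 ≤ w) (c : ℕ) {f : (ℕ → Fin (2 ^ w)) → ℝ}
    (hf : Measurable f) (h : ∀ ω, f (flipAt w c ω) = -f ω) : ∫ ω, f ω ∂randomWords w = 0 := by
  have h1 : ∫ ω, f ω ∂randomWords w = ∫ ω, f (flipAt w c ω) ∂randomWords w := by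
    have hp := measurePreserving_flipAt hw c
    conv_lhs => rw [← hp.map_eq]
    exact integral_map hp.measurable.aemeasurable hf.aestronglyMeasurable
  simp only [h, integral_neg] at h1
  linarith

/-- Distinct pairs of words give uncorrelated collision terms: some word occurs in exactly one of
the two terms, and flipping its sign negates the product. -/
theorem integral_collision_mul_eq_zero {w : ℕ} (hw : 1 ≤ w) {k a b a' b' : ℕ} (hab : a < b)
    (hab' : a' < b') (hne : (a, b) ≠ (a', b')) :
    ∫ ω, collision k a b ω * collision k a' b' ω ∂randomWords w = 0 := by
  have hm : Measurable fun ω : ℕ → Fin (2 ^ w) => collision k a b ω * collision k a' b' ω :=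
    (measurable_collision k a b w).mul (measurable_collision k a' b' w)
  rcases lt_trichotomy b b' with h | h | h
  · refine integral_eq_zero_of_flip hw b' hm fun ω => ?_
    rw [collision_flipAt_of_ne (by omega) (by omega), collision_flipAt_right hw (by omega)]
    ring
  · subst h
    have : a ≠ a' := fun h => hne (by rw [h])
    refine integral_eq_zero_of_flip hw a hm fun ω => ?_
    rw [collision_flipAt_of_ne (a := a') (by omega) (by omega),
      collision_flipAt_left hw (by omega)]
    ring
  · refine integral_eq_zero_of_flip hw b hm fun ω => ?_
    rw [collision_flipAt_of_ne (a := a') (by omega) (by omega),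
      collision_flipAt_right hw (by omega)]
    ring

/-- The number of buckets need not divide the number of words; the factor `2` absorbs the rounding. -/
theorem uniformWord_bucket_le {w k : ℕ} (hk : 1 ≤ k) (hkw : 2 * k ≤ 2 ^ w) (b : ℕ) :
    uniformWord w {v | wordBucket k v = b} ≤ ENNReal.ofReal (2 / k) := by
  classical
  have hcard : Fintype.card {v : Fin (2 ^ w) | wordBucket k v = b} ≤ 2 * (2 ^ w / (2 * k) + 1) := by
    rw [Fintype.card_subtype]
    -- Within a bucket, a word is determined by its lowest bit and the quotient `v / 2 / k`.
    refine le_of_le_of_eq (b := (Finset.range 2 ×ˢ Finset.range (2 ^ w / (2 * k) + 1)).card) ?_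
      (by rw [Finset.card_product, Finset.card_range, Finset.card_range])
    refine Finset.card_le_card_of_injOn (fun v => ((v : ℕ) % 2, (v : ℕ) / 2 / k)) ?_ ?_
    · intro v _
      simp only [Finset.coe_product, Set.mem_prod, Finset.coe_range, Set.mem_Iio]
      refine ⟨Nat.mod_lt _ two_pos, ?_⟩
      rw [Nat.div_div_eq_div_mul]
      exact Nat.lt_succ_of_le (Nat.div_le_div_right v.2.le)
    · intro u hu v hv huv
      have hu : (u : ℕ) / 2 % k = b := (Finset.mem_filter.mp hu).2
      have hv : (v : ℕ) / 2 % k = b := (Finset.mem_filter.mp hv).2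
      simp only [Prod.mk.injEq] at huv
      have h2 : (u : ℕ) / 2 = v / 2 := by
        rw [← Nat.div_add_mod ((u : ℕ) / 2) k, ← Nat.div_add_mod ((v : ℕ) / 2) k, hu, hv, huv.2]
      apply Fin.ext
      omega
  rw [PMF.toMeasure_uniformOfFintype_apply _ (Set.Finite.measurableSet (Set.toFinite _))]
  have hW : (0 : ℝ) < 2 ^ w := by positivity
  have hk0 : (0 : ℝ) < k := by exact_mod_cast hk
  have hreal : (Fintype.card {v : Fin (2 ^ w) | wordBucket k v = b} : ℝ) / 2 ^ w ≤ 2 / k := by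
    have h1 : (Fintype.card {v : Fin (2 ^ w) | wordBucket k v = b} : ℝ) ≤
        2 * (2 ^ w / (2 * k) + 1) := by
      refine (Nat.cast_le.mpr hcard).trans ?_
      push_cast
      have := @Nat.cast_div_le ℝ _ _ _ (2 ^ w) (2 * k)
      push_cast at this
      linarith
    have h2 : (1 : ℝ) ≤ 2 ^ w / (2 * k) := by
      rw [le_div_iff₀ (by positivity), one_mul]
      exact_mod_cast hkw
    rw [div_le_iff₀ hW]
    have h3 : 2 / (k : ℝ) * 2 ^ w = 4 * (2 ^ w / (2 * k)) := by field_simp; norm_num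
    rw [h3]
    linarith
  rw [Fintype.card_fin]
  calc _ = ENNReal.ofReal ((Fintype.card {v : Fin (2 ^ w) | wordBucket k v = b} : ℝ) / 2 ^ w) := by
        rw [ENNReal.ofReal_div_of_pos hW, ENNReal.ofReal_natCast,
          ENNReal.ofReal_pow (by norm_num)]
        norm_num
    _ ≤ _ := ENNReal.ofReal_le_ofReal hreal

theorem integral_collision_sq_le {w k : ℕ} (hk : 1 ≤ k) (hkw : 2 * k ≤ 2 ^ w)
    {a b : ℕ} (hab : a ≠ b) :
    ∫ ω, collision k a b ω * collision k a b ω ∂randomWords w ≤ 2 / k := by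
  have hset : MeasurableSet {z : Fin (2 ^ w) × Fin (2 ^ w) |
      wordBucket k z.1 = wordBucket k z.2} := Set.Finite.measurableSet (Set.toFinite _)
  have hpair : Measurable fun ω : ℕ → Fin (2 ^ w) => (ω a, ω b) := by fun_prop
  have hE : MeasurableSet {ω : ℕ → Fin (2 ^ w) | wordBucket k (ω a) = wordBucket k (ω b)} :=
    hset.preimage hpair
  have h1 : ∀ ω : ℕ → Fin (2 ^ w), collision k a b ω * collision k a b ω =
      Set.indicator {ω : ℕ → Fin (2 ^ w) | wordBucket k (ω a) = wordBucket k (ω b)} 1 ω := by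
    intro ω
    have e1 : ∀ v, (wordSign v : ℝ) * wordSign v = 1 := fun v => by
      exact_mod_cast wordSign_mul_self v
    by_cases h : wordBucket k (ω a) = wordBucket k (ω b)
    · rw [Set.indicator_of_mem (by exact h)]
      simp only [collision, h, if_true, Pi.one_apply]
      rw [mul_mul_mul_comm, e1, e1, one_mul]
    · rw [Set.indicator_of_notMem (by exact h)]
      simp [collision, h]
  simp only [h1]
  rw [integral_indicator_one hE]
  refine ENNReal.toReal_le_of_le_ofReal (by positivity) ?_
  have h2 : randomWords w {ω | wordBucket k (ω a) = wordBucket k (ω b)} =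
      ((uniformWord w).prod (uniformWord w)) {z | wordBucket k z.1 = wordBucket k z.2} := by
    rw [← Measure.infinitePi_map_eval_prod (P := fun _ : ℕ => uniformWord w) hab]
    rw [Measure.map_apply hpair hset]
    rfl
  rw [h2, Measure.prod_apply hset]
  calc _ ≤ ∫⁻ _ : Fin (2 ^ w), ENNReal.ofReal (2 / k) ∂uniformWord w := by
        refine lintegral_mono fun v => ?_
        refine le_trans (measure_mono ?_) (uniformWord_bucket_le hk hkw (wordBucket k v))
        intro u hu
        exact Eq.symm hu
    _ = _ := by simp

/-- The second moment of a linear combination of collision terms. -/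
theorem integral_sq_sum_collision_le {w k : ℕ} (hw : 1 ≤ w) (hk : 1 ≤ k) (hkw : 2 * k ≤ 2 ^ w)
    {m : ℕ} {p : Fin m → ℕ} (hp : StrictMono p) (A : Finset (Fin m × Fin m))
    (hA : ∀ e ∈ A, e.1 < e.2) (g : Fin m × Fin m → ℝ) (c : ℝ) (hg : ∀ e ∈ A, |g e| ≤ c) :
    ∫ ω, (∑ e ∈ A, g e * collision k (p e.1) (p e.2) ω) ^ 2 ∂randomWords w ≤
      A.card * (c ^ 2 * (2 / k)) := by
  have h1 : ∀ ω : ℕ → Fin (2 ^ w), (∑ e ∈ A, g e * collision k (p e.1) (p e.2) ω) ^ 2 =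
      ∑ e ∈ A, ∑ f ∈ A, (g e * g f) *
        (collision k (p e.1) (p e.2) ω * collision k (p f.1) (p f.2) ω) := by
    intro ω
    rw [sq, Finset.sum_mul_sum]
    refine Finset.sum_congr rfl fun e _ => Finset.sum_congr rfl fun f _ => by ring
  simp only [h1]
  rw [integral_finsetSum _ fun e _ => integrable_finsetSum _ fun f _ =>
    (integrable_collision_mul ..).const_mul _]
  rw [← nsmul_eq_mul]
  refine Finset.sum_le_card_nsmul _ _ _ fun e he => ?_
  rw [integral_finsetSum _ fun f _ => (integrable_collision_mul ..).const_mul _]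
  rw [Finset.sum_eq_single_of_mem e he]
  · rw [integral_const_mul]
    have h2 : g e * g e ≤ c ^ 2 := by
      rw [← sq]
      exact sq_le_sq' (by linarith [neg_abs_le (g e), hg e he]) ((le_abs_self _).trans (hg e he))
    refine mul_le_mul h2 (integral_collision_sq_le hk hkw (hp (hA e he)).ne)
      (integral_nonneg fun ω => mul_self_nonneg _) (sq_nonneg _)
  · intro f hf hfe
    rw [integral_const_mul, integral_collision_mul_eq_zero hw (hp (hA e he)) (hp (hA f hf)),
      mul_zero]
    intro h
    simp only [Prod.mk.injEq, hp.injective.eq_iff] at h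
    exact hfe (Prod.ext h.1.symm h.2.symm)

/-! ### The estimator and Chebyshev's inequality -/

/-- The contribution to coordinate `c` of the sketch made by the letter `a` at a position whose
random word is `v`. -/
def contribution (k v a c : ℕ) : ℤ := if c = a * k + wordBucket k v then wordSign v else 0

/-- The squared Euclidean norm of the difference of the sketches of two strings `P` and `T` of
length `m`, when their `j`-th letters are hashed by the random word `v j`. -/
def sketchDist (q k m : ℕ) (v P T : Fin m → ℕ) : ℤ :=
  ∑ c ∈ Finset.range (q * k),
    (∑ j, (contribution k (v j) (P j) c - contribution k (v j) (T j) c)) ^ 2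

theorem wordBucket_lt {k : ℕ} (hk : 1 ≤ k) (v : ℕ) : wordBucket k v < k := Nat.mod_lt _ hk

theorem coord_inj {k a b x y : ℕ} (hx : x < k) (hy : y < k) (h : a * k + x = b * k + y) :
    a = b ∧ x = y := by
  have hk : 0 < k := by omega
  have h1 : (a * k + x) / k = a := by
    rw [mul_comm, Nat.mul_add_div hk, Nat.div_eq_of_lt hx, add_zero]
  have h2 : (b * k + y) / k = b := by
    rw [mul_comm, Nat.mul_add_div hk, Nat.div_eq_of_lt hy, add_zero]
  have : a = b := by rw [← h1, ← h2, h]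
  subst this
  omega

theorem coord_lt {q k a x : ℕ} (ha : a < q) (hx : x < k) : a * k + x < q * k := by
  calc a * k + x < a * k + k := by omega
    _ = (a + 1) * k := by ring
    _ ≤ q * k := Nat.mul_le_mul_right _ ha

/-- The inner product of two contributions. -/
theorem sum_contribution_mul {q k : ℕ} (hk : 1 ≤ k) {a : ℕ} (ha : a < q) (b v u : ℕ) :
    ∑ c ∈ Finset.range (q * k), contribution k v a c * contribution k u b c =
      (if wordBucket k v = wordBucket k u then wordSign v * wordSign u else 0) *
        (if a = b then 1 else 0) := by
  rw [Finset.sum_eq_single_of_mem (a * k + wordBucket k v)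
    (Finset.mem_range.mpr (coord_lt ha (wordBucket_lt hk v)))]
  · simp only [contribution, if_true]
    by_cases h : a * k + wordBucket k v = b * k + wordBucket k u
    · obtain ⟨h1, h2⟩ := coord_inj (wordBucket_lt hk v) (wordBucket_lt hk u) h
      simp [h1, h2]
    · have : ¬ (wordBucket k v = wordBucket k u ∧ a = b) := by
        rintro ⟨h1, h2⟩; rw [h1, h2] at h; exact h rfl
      rw [if_neg h]
      by_cases h1 : wordBucket k v = wordBucket k u
      · simp [h1] at this; simp [this]
      · simp [h1]
  · intro c _ hc
    simp [contribution, hc]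

/-- The inner product of `e_a - e_b` and `e_a' - e_b'` for unit vectors indexed by letters. -/
def letterGram (a b a' b' : ℕ) : ℤ :=
  (if a = a' then 1 else 0) - (if a = b' then 1 else 0) - (if b = a' then 1 else 0) +
    (if b = b' then 1 else 0)

theorem abs_letterGram_le (a b a' b' : ℕ) : |letterGram a b a' b'| ≤ 2 := by
  unfold letterGram
  split_ifs <;> norm_num

theorem letterGram_self (a b : ℕ) : letterGram a b a b = if a ≠ b then 2 else 0 := by
  unfold letterGram
  by_cases h : a = b
  · simp [h]
  · simp [h, Ne.symm h]

theorem letterGram_left (a a' b' : ℕ) : letterGram a a a' b' = 0 := by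
  unfold letterGram; ring

theorem letterGram_right (a b a' : ℕ) : letterGram a b a' a' = 0 := by
  unfold letterGram; ring

theorem letterGram_comm (a b a' b' : ℕ) : letterGram a b a' b' = letterGram a' b' a b := by
  unfold letterGram
  simp only [eq_comm (a := a'), eq_comm (a := b')]
  ring

theorem sum_sum_eq_diag_add {m : ℕ} (f : Fin m → Fin m → ℤ) (hf : ∀ i j, f i j = f j i) :
    ∑ i, ∑ j, f i j =
      ∑ i, f i i + 2 * ∑ e ∈ Finset.univ.filter (fun e : Fin m × Fin m => e.1 < e.2), f e.1 e.2 := by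
  have h1 : ∑ i, ∑ j, f i j = ∑ i, ∑ j, ((if i = j then f i j else 0) +
      (if i < j then f i j else 0) + (if j < i then f i j else 0)) := by
    refine Finset.sum_congr rfl fun i _ => Finset.sum_congr rfl fun j _ => ?_
    rcases lt_trichotomy i j with h | h | h
    · simp [h, h.ne, h.not_gt]
    · simp [h]
    · simp [h, h.ne', h.not_gt]
  have h2 : ∑ i, ∑ j, (if j < i then f i j else 0) = ∑ i, ∑ j, (if i < j then f i j else 0) := by
    rw [Finset.sum_comm]
    refine Finset.sum_congr rfl fun i _ => Finset.sum_congr rfl fun j _ => ?_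
    rw [hf]
  rw [h1, Finset.sum_filter, ← Finset.univ_product_univ, Finset.sum_product]
  simp only [Finset.sum_add_distrib, h2, Finset.sum_ite_eq, Finset.mem_univ, if_true]
  ring

/-- The estimator is `2 d` plus a combination of uncorrelated collision terms. -/
theorem sketchDist_eq {q k m : ℕ} (hk : 1 ≤ k) (v P T : Fin m → ℕ) (hP : ∀ j, P j < q)
    (hT : ∀ j, T j < q) :
    sketchDist q k m v P T = 2 * hammingDist P T +
      2 * ∑ e ∈ Finset.univ.filter (fun e : Fin m × Fin m => e.1 < e.2),
        (if wordBucket k (v e.1) = wordBucket k (v e.2) then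
          wordSign (v e.1) * wordSign (v e.2) else 0) *
        letterGram (P e.1) (T e.1) (P e.2) (T e.2) := by
  have h1 : sketchDist q k m v P T = ∑ i, ∑ j,
      (if wordBucket k (v i) = wordBucket k (v j) then wordSign (v i) * wordSign (v j) else 0) *
        letterGram (P i) (T i) (P j) (T j) := by
    unfold sketchDist
    simp only [sq, Finset.sum_mul_sum]
    rw [Finset.sum_comm]
    refine Finset.sum_congr rfl fun i _ => ?_
    rw [Finset.sum_comm]
    refine Finset.sum_congr rfl fun j _ => ?_
    simp only [sub_mul, mul_sub, Finset.sum_sub_distrib]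
    rw [sum_contribution_mul hk (hP i), sum_contribution_mul hk (hP i),
      sum_contribution_mul hk (hT i), sum_contribution_mul hk (hT i)]
    unfold letterGram
    ring
  rw [h1, sum_sum_eq_diag_add]
  · congr 1
    simp only [if_true, wordSign_mul_self, one_mul, letterGram_self, ← Finset.sum_filter,
      Finset.sum_const, hammingDist]
    rw [nsmul_eq_mul, mul_comm]
  · intro i j
    rw [letterGram_comm]
    simp only [eq_comm (a := wordBucket k (v i)), mul_comm (wordSign (v i))]

theorem sketchDist_self_zero {q k m : ℕ} (v P : Fin m → ℕ) : sketchDist q k m v P P = 0 := by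
  simp [sketchDist]

/-- The estimator is within relative error `1 / (3 K)` of its mean, except with probability at most
`72 K² / k`: Chebyshev's inequality. -/
theorem randomWords_sketchDist_le {q k m w K : ℕ} (hw : 1 ≤ w) (hk : 1 ≤ k) (hkw : 2 * k ≤ 2 ^ w)
    (hK : 1 ≤ K) {p : Fin m → ℕ} (hp : StrictMono p) (P T : Fin m → ℕ) (hP : ∀ j, P j < q)
    (hT : ∀ j, T j < q) :
    randomWords w {ω | ¬ 3 * (K : ℤ) * |sketchDist q k m (fun j => ω (p j)) P T -
        2 * hammingDist P T| ≤ 2 * hammingDist P T} ≤ ENNReal.ofReal (72 * K ^ 2 / k) := by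
  classical
  rcases Nat.eq_zero_or_pos (hammingDist P T) with hd | hd
  · have : P = T := hammingDist_eq_zero.mp hd
    subst this
    simp [sketchDist_self_zero]
  set d := hammingDist P T with hd_def
  set D : Finset (Fin m) := Finset.univ.filter (fun j => P j ≠ T j) with hD
  have hDd : D.card = d := rfl
  -- Only pairs of mismatches contribute to the deviation, and there are at most `d ^ 2` of them.
  set A : Finset (Fin m × Fin m) := (D ×ˢ D).filter (fun e => e.1 < e.2) with hA
  let g : Fin m × Fin m → ℝ := fun e => (letterGram (P e.1) (T e.1) (P e.2) (T e.2) : ℝ)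
  let Y : (ℕ → Fin (2 ^ w)) → ℝ := fun ω => ∑ e ∈ A, g e * collision k (p e.1) (p e.2) ω
  have hY : ∀ ω : ℕ → Fin (2 ^ w),
      ((sketchDist q k m (fun j => ω (p j)) P T - 2 * d : ℤ) : ℝ) = 2 * Y ω := by
    intro ω
    rw [sketchDist_eq hk _ P T hP hT, ← hd_def, add_sub_cancel_left]
    push_cast
    congr 1
    symm
    refine Finset.sum_subset_zero_on_sdiff ?_ ?_ ?_
    · intro e he
      simp only [hA, Finset.mem_filter] at he
      simp [he.2]
    · intro e he
      simp only [hA, hD, Finset.mem_sdiff, Finset.mem_filter, Finset.mem_univ, true_and,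
        Finset.mem_product] at he
      by_cases h1 : P e.1 = T e.1
      · rw [h1, letterGram_left]; simp
      · by_cases h2 : P e.2 = T e.2
        · rw [h2, letterGram_right]; simp
        · exact absurd ⟨⟨h1, h2⟩, he.1⟩ he.2
    · intro e _
      simp only [g, collision]
      rw [mul_comm]
  have hYm : Measurable Y :=
    Finset.measurable_sum _ fun e _ => (measurable_collision _ _ _ w).const_mul _
  have hYb : ∀ ω, |Y ω| ≤ ∑ e ∈ A, |g e| := fun ω => by
    refine (Finset.abs_sum_le_sum_abs _ _).trans (Finset.sum_le_sum fun e _ => ?_)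
    rw [abs_mul]
    exact mul_le_of_le_one_right (abs_nonneg _) (abs_collision_le ..)
  have hYi : Integrable (fun ω => Y ω ^ 2) (randomWords w) := by
    refine Integrable.of_bound (hYm.pow_const 2).aestronglyMeasurable ((∑ e ∈ A, |g e|) ^ 2)
      (Filter.Eventually.of_forall fun ω => ?_)
    rw [Real.norm_eq_abs, abs_pow]
    exact pow_le_pow_left₀ (abs_nonneg _) (hYb ω) 2
  have hmom : ∫ ω, Y ω ^ 2 ∂randomWords w ≤ 8 * d ^ 2 / k := by
    refine (integral_sq_sum_collision_le hw hk hkw hp A (fun e he => (Finset.mem_filter.mp he).2)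
      g 2 fun e _ => ?_).trans ?_
    · simp only [g]
      exact_mod_cast abs_letterGram_le _ _ _ _
    · have : (A.card : ℝ) ≤ d ^ 2 := by
        have h1 := Finset.card_filter_le (D ×ˢ D) (fun e => e.1 < e.2)
        rw [Finset.card_product, hDd, ← sq] at h1
        exact_mod_cast h1
      calc _ ≤ (d : ℝ) ^ 2 * (2 ^ 2 * (2 / k)) := by gcongr
        _ = _ := by ring
  have hk0 : (0 : ℝ) < k := by exact_mod_cast hk
  have hK0 : (0 : ℝ) < K := by exact_mod_cast hK
  have hd0 : (0 : ℝ) < d := by exact_mod_cast hd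
  have hcheb := mul_meas_ge_le_integral_of_nonneg (μ := randomWords w)
    (f := fun ω => Y ω ^ 2) (Filter.Eventually.of_forall fun ω => sq_nonneg _) hYi
    ((d / (3 * K)) ^ 2)
  have hsub : {ω : ℕ → Fin (2 ^ w) | ¬ 3 * (K : ℤ) *
      |sketchDist q k m (fun j => ω (p j)) P T - 2 * d| ≤ 2 * d} ⊆
      {ω | ((d : ℝ) / (3 * K)) ^ 2 ≤ Y ω ^ 2} := by
    intro ω hω
    simp only [Set.mem_ofPred_eq, not_le] at hω ⊢
    have h1 : (2 * d : ℝ) < 3 * K * |2 * Y ω| := by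
      rw [← hY ω]
      exact_mod_cast hω
    rw [abs_mul, abs_two] at h1
    rw [← sq_abs (Y ω)]
    refine pow_le_pow_left₀ (by positivity) ?_ 2
    rw [div_le_iff₀ (by positivity)]
    linarith
  refine (measure_mono hsub).trans ?_
  refine (ENNReal.le_ofReal_iff_toReal_le (measure_ne_top _ _) (by positivity)).mpr ?_
  have h3 := hcheb.trans hmom
  change _ * (randomWords w _).toReal ≤ _ at h3
  have h4 : 8 * (d : ℝ) ^ 2 / k = (d / (3 * K)) ^ 2 * (72 * K ^ 2 / k) := by
    field_simp; norm_num
  rw [h4] at h3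
  exact le_of_mul_le_mul_left h3 (by positivity)

end WordRAM

namespace DynApproxHD

open WordRAM WordRAM.Prog WordRAM.Operand

/-! ### Memory layout, hashing a letter, and changing a sketch -/

/-- The numerical constraints under which the programs work: `k` buckets per letter, sketches of
length `L = q * k`, and enough words and enough bits for the memory layout. The bound on `K`
leaves room for the product of the estimate with `3 K` that precedes the final division. -/
structure Layout (q n m k L K w S : ℕ) : Prop where
  one_le_m : 1 ≤ m
  m_le_n : m ≤ n
  one_le_K : 1 ≤ K
  one_le_q : 1 ≤ q
  buckets : 16 * K ≤ k
  dim : L = q * k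
  space : m + 2 * n + 4 * n * L ≤ S
  word : m + 2 * n + 4 * n * L < 2 ^ w

/-- The registers set up by the preprocessing. Of the others, `0` and `1` hold the arguments of an
operation, `10` to `14` control loops, `15` accumulates the estimate, `16`, `17` and `18` hold a hash
position, a letter and the address of a letter, `20` and `21` a coordinate of a sketch and the amount
to be added to it; those from `22` on are scratch. -/
structure Frame (n m k L K : ℕ) (s : Config) : Prop where
  accuracy : s.reg 2 = K
  textLen : s.reg 3 = n
  patternLen : s.reg 4 = m
  buckets : s.reg 5 = k
  dim : s.reg 6 = L
  words : s.reg 7 = m + n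
  rows : s.reg 8 = m + 2 * n
  dynRows : s.reg 9 = m + 2 * n + n * L

theorem Frame.congr {n m k L K : ℕ} {s s' : Config} (h : Frame n m k L K s)
    (h' : ∀ r, 2 ≤ r → r < 10 → s'.reg r = s.reg r) : Frame n m k L K s' where
  accuracy := by rw [h' 2 (by norm_num) (by norm_num), h.accuracy]
  textLen := by rw [h' 3 (by norm_num) (by norm_num), h.textLen]
  patternLen := by rw [h' 4 (by norm_num) (by norm_num), h.patternLen]
  buckets := by rw [h' 5 (by norm_num) (by norm_num), h.buckets]
  dim := by rw [h' 6 (by norm_num) (by norm_num), h.dim]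
  words := by rw [h' 7 (by norm_num) (by norm_num), h.words]
  rows := by rw [h' 8 (by norm_num) (by norm_num), h.rows]
  dynRows := by rw [h' 9 (by norm_num) (by norm_num), h.dynRows]

/-- The address of coordinate `c` of the sketch in row `r`. Rows below `n` hold the sketches of the
alignments of the fixed string. The rows from `n` on belong to the updatable string: the sketch of
the pattern is row `n`, and node `v` of the segment tree of the text is row `n + v`. -/
def cell (n m L r c : ℕ) : ℕ := m + 2 * n + r * L + c

theorem Layout.one_le_k {q n m k L K w S : ℕ} (hl : Layout q n m k L K w S) : 1 ≤ k := by
  have := hl.buckets; have := hl.one_le_K; omega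

theorem Layout.k_le_L {q n m k L K w S : ℕ} (hl : Layout q n m k L K w S) : k ≤ L := by
  rw [hl.dim]; exact Nat.le_mul_of_pos_left _ hl.one_le_q

theorem Layout.L_le {q n m k L K w S : ℕ} (hl : Layout q n m k L K w S) : 4 * L ≤ 4 * n * L :=
  Nat.mul_le_mul_right _ (by have := hl.one_le_m; have := hl.m_le_n; omega)

/-- Small constants fit into a word. -/
theorem Layout.lt_word {q n m k L K w S : ℕ} (hl : Layout q n m k L K w S) {v : ℕ}
    (hv : v ≤ 64) : v < 2 ^ w := by
  have := hl.one_le_k; have := hl.k_le_L; have := hl.L_le; have := hl.word; have := hl.buckets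
  have := hl.one_le_K
  omega

theorem cell_lt {n m L r c : ℕ} (hr : r < 4 * n) (hc : c < L) :
    cell n m L r c < m + 2 * n + 4 * n * L := by
  have : (r + 1) * L ≤ 4 * n * L := Nat.mul_le_mul_right _ hr
  rw [add_mul] at this
  unfold cell
  omega

theorem cell_lt_cell {n m L r r' c : ℕ} (hr : r < r') (hc : c < L) :
    cell n m L r c < m + 2 * n + r' * L := by
  have : (r + 1) * L ≤ r' * L := Nat.mul_le_mul_right _ hr
  rw [add_mul] at this
  unfold cell
  omega

theorem cell_inj {n m L r r' c c' : ℕ} (hc : c < L) (hc' : c' < L) :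
    cell n m L r c = cell n m L r' c' ↔ r = r' ∧ c = c' := by
  refine ⟨fun h => ?_, by rintro ⟨rfl, rfl⟩; rfl⟩
  exact coord_inj hc hc' (by unfold cell at h; omega)

/-- The word arithmetic computing the address of a cell does not overflow. -/
theorem Layout.cell_word {q n m k L K w S : ℕ} (hl : Layout q n m k L K w S) {r c : ℕ}
    (hr : r < 4 * n) (hc : c < L) :
    (((r * L) % 2 ^ w + (m + 2 * n)) % 2 ^ w + c) % 2 ^ w = cell n m L r c := by
  have h1 := cell_lt (m := m) hr hc
  have h2 := hl.word
  simp only [Nat.mod_add_mod]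
  rw [Nat.mod_eq_of_lt] <;> unfold cell at * <;> omega

/-- The same for a cell in a row of the updatable string. -/
theorem Layout.dynCell_word {q n m k L K w S : ℕ} (hl : Layout q n m k L K w S) {r c : ℕ}
    (hr : r < 3 * n) (hc : c < L) :
    (((r * L) % 2 ^ w + (m + 2 * n + n * L)) % 2 ^ w + c) % 2 ^ w = cell n m L (n + r) c := by
  have h1 := cell_lt (m := m) (show n + r < 4 * n by omega) hc
  have h2 := hl.word
  simp only [Nat.mod_add_mod]
  rw [Nat.mod_eq_of_lt] <;> unfold cell at * <;> rw [add_mul] at * <;> omega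

/-- Compute the coordinate (register 20) and the sign (register 21) to which the letter in register
17 at the hash position in register 16 contributes. -/
def hashAt : Prog :=
  op .add 22 (reg 7) (reg 16) ;; load 22 (reg 22) ;;
  op .mod 21 (reg 22) (const 2) ;; op .mul 21 (reg 21) (const 2) ;; op .sub 21 (const 1) (reg 21) ;;
  op .div 22 (reg 22) (const 2) ;; op .mod 20 (reg 22) (reg 5) ;;
  op .mul 22 (reg 17) (reg 5) ;; op .add 20 (reg 22) (reg 20)

theorem cast_sub_word {w a b : ℕ} (hb : b ≤ 2 ^ w) :
    (((a + (2 ^ w - b)) % 2 ^ w : ℕ) : ZMod (2 ^ w)) = a - b := by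
  rw [ZMod.natCast_mod, Nat.cast_add, Nat.cast_sub hb, ZMod.natCast_self]
  ring

theorem runs_hashAt {q n m k L K w S : ℕ} (hl : Layout q n m k L K w S) (ω : ℕ → Fin (2 ^ w))
    {s : Config} (hf : Frame n m k L K s) {p a v : ℕ} (hp : s.reg 16 = p) (hpn : p < n)
    (ha : s.reg 17 = a) (haq : a < q) (hv : s.mem (m + n + p) = v) :
    Runs w S ω hashAt s 9 fun s' => (∀ r < 20, s'.reg r = s.reg r) ∧ s'.mem = s.mem ∧
      s'.reg 20 = a * k + wordBucket k v ∧ s'.reg 21 < 2 ^ w ∧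
      (s'.reg 21 : ZMod (2 ^ w)) = (wordSign v : ℤ) := by
  have hk := hl.one_le_k
  have hword := hl.word
  have h2 : 2 % 2 ^ w = 2 := Nat.mod_eq_of_lt (hl.lt_word (by norm_num))
  have h1 : 1 % 2 ^ w = 1 := Nat.mod_eq_of_lt (hl.lt_word (by norm_num))
  have h4 : 2 < 2 ^ w := hl.lt_word (by norm_num)
  have hL := hl.L_le
  have haddr : (m + n + p) % 2 ^ w = m + n + p := Nat.mod_eq_of_lt (by omega)
  have hspace := hl.space
  refine Runs.op_seq (Runs.load_seq ?_ (Runs.op_seq (Runs.op_seq (Runs.op_seq (Runs.op_seq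
    (Runs.op_seq (Runs.op_seq (Runs.op ?_))))))))
  · simp [BinOp.eval, hf.words, hp, haddr]
    omega
  · refine ⟨?_, ?_, ?_, ?_, ?_⟩
    · intro r hr
      simp [show r ≠ 20 by omega, show r ≠ 21 by omega, show r ≠ 22 by omega]
    · rfl
    · simp only [BinOp.eval, Config.setReg_reg, Operand.val_reg, Operand.val_const, if_true, if_false,
        Nat.reduceEqDiff, hf.words, hp, haddr, h2, ha, hf.buckets,
        Config.setReg_mem, hv]
      have hlt : a * k + wordBucket k v < 2 ^ w := by
        have := coord_lt haq (wordBucket_lt hk v)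
        rw [← hl.dim] at this
        omega
      rw [Nat.mod_add_mod]
      exact Nat.mod_eq_of_lt hlt
    · simp only [BinOp.eval, Config.setReg_reg, if_true, if_false, Nat.reduceEqDiff]
      exact Nat.mod_lt _ (by positivity)
    · simp only [BinOp.eval, Config.setReg_reg, Operand.val_reg, Operand.val_const, if_true, if_false,
        Nat.reduceEqDiff, hf.words, hp, haddr, h2, h1, Config.setReg_mem, hv]
      rw [cast_sub_word (Nat.mod_lt _ (by positivity)).le, ZMod.natCast_mod]
      simp only [wordSign, Int.cast_sub, Int.cast_mul, Int.cast_one, Int.cast_ofNat,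
        Int.cast_natCast, Nat.cast_mul, Nat.cast_one, Nat.cast_ofNat]
      ring

/-- Add the word in register 21 to the coordinate in register 20 of the contribution of the position
in register 16 of the updatable string. If the pattern is updated there is a single sketch; if the
text is updated, the sketches form a segment tree with root `1`, in which the children of `v` are
`2 v` and `2 v + 1` and the leaf of position `j` is `n + j`. -/
def addDyn : Mode → Prog
  | .patternOnly =>
    op .add 22 (reg 9) (reg 20) ;; load 23 (reg 22) ;; op .add 23 (reg 23) (reg 21) ;;
    store (reg 22) (reg 23)
  | .textOnly =>
    op .add 24 (reg 3) (reg 16) ;;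
    whileNZ (reg 24) (
      op .mul 22 (reg 24) (reg 6) ;; op .add 22 (reg 22) (reg 9) ;; op .add 22 (reg 22) (reg 20) ;;
      load 23 (reg 22) ;; op .add 23 (reg 23) (reg 21) ;; store (reg 22) (reg 23) ;;
      op .div 24 (reg 24) (const 2))

/-- The number of steps allowed for `addDyn`. -/
def addDynTime (n : ℕ) : Mode → ℕ
  | .patternOnly => 4
  | .textOnly => 1 + ((Nat.log 2 n + 2) * (7 + 1) + 1)

/-- The memory `mem` represents the contributions `f j c` of the positions `j` of the updatable
string to the coordinates `c`. The length `n` need not be a power of two, so a tree node need not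
stand for an interval of positions; only the equations between a node and its children matter. -/
def DynRep (n m L w : ℕ) : Mode → (ℕ → ℕ) → (ℕ → ℕ → ZMod (2 ^ w)) → Prop
  | .patternOnly, mem, f => ∀ c < L, (mem (cell n m L n c) : ZMod (2 ^ w)) =
      ∑ j ∈ Finset.range m, f j c
  | .textOnly, mem, f =>
      (∀ j < n, ∀ c < L, (mem (cell n m L (n + (n + j)) c) : ZMod (2 ^ w)) = f j c) ∧
      ∀ v, 1 ≤ v → v < n → ∀ c < L, (mem (cell n m L (n + v) c) : ZMod (2 ^ w)) =
        mem (cell n m L (n + 2 * v) c) + mem (cell n m L (n + (2 * v + 1)) c)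

theorem Mode.len_le {n m : ℕ} (h : m ≤ n) (M : Mode) : M.len n m ≤ n := by
  cases M <;> simp [Mode.len, h]

theorem lt_two_pow_log_add_two {n : ℕ} : 2 * n < 2 ^ (Nat.log 2 n + 2) := by
  have := Nat.lt_pow_succ_log_self (b := 2) (by norm_num) n
  rw [pow_succ]
  omega

theorem runs_addDyn {q n m k L K w S : ℕ} (hl : Layout q n m k L K w S) (ω : ℕ → Fin (2 ^ w))
    (M : Mode) {s : Config} (hf : Frame n m k L K s) {j c d : ℕ} (hj : s.reg 16 = j)
    (hjn : j < M.len n m) (hc : s.reg 20 = c) (hcL : c < L) (hd : s.reg 21 = d) :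
    Runs w S ω (addDyn M) s (addDynTime n M) fun s' => (∀ r < 20, s'.reg r = s.reg r) ∧
      (∀ a < m + 2 * n + n * L, s'.mem a = s.mem a) ∧
      ∀ f, DynRep n m L w M s.mem f → DynRep n m L w M s'.mem
        fun j' c' => f j' c' + if j' = j ∧ c' = c then (d : ZMod (2 ^ w)) else 0 := by
  have hword := hl.word
  have hspace := hl.space
  have hn : 1 ≤ n := hl.one_le_m.trans hl.m_le_n
  have hL := hl.L_le
  cases M with
  | patternOnly =>
    have hcell := hl.dynCell_word (r := 0) (by omega) hcL
    simp only [zero_mul, Nat.zero_mod, zero_add, add_zero] at hcell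
    rw [Nat.mod_add_mod] at hcell
    have hlt := cell_lt (m := m) (show n < 4 * n by omega) hcL
    refine Runs.op_seq (Runs.load_seq ?_ (Runs.op_seq (Runs.store ?_ ?_)))
    · simp [BinOp.eval, hf.dynRows, hc, hcell]; omega
    · simp [BinOp.eval, hf.dynRows, hc, hcell]; omega
    · simp only [BinOp.eval, Config.setReg_reg, Operand.val_reg, if_true, if_false,
        Nat.reduceEqDiff, hf.dynRows, hc, hcell, Config.setReg_mem, hd, Config.setMem_reg,
        Config.setMem_mem]
      refine ⟨?_, ?_, ?_⟩
      · intro r hr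
        simp [show r ≠ 22 by omega, show r ≠ 23 by omega]
      · intro a ha
        rw [Function.update_of_ne]
        unfold cell
        omega
      · intro f hf' c' hc'
        simp only [Function.update_apply, cell_inj hc' hcL, true_and, Finset.sum_add_distrib]
        by_cases h : c' = c
        · subst h
          simp only [if_true, ZMod.natCast_mod, Nat.cast_add, hf' c' hc', and_true]
          rw [Finset.sum_ite_eq' (Finset.range m) j, if_pos (Finset.mem_range.mpr (show j < m from hjn))]
        · simp [h, hf' c' hc']
  | textOnly =>
    replace hjn : j < n := hjn
    have h2 : 2 % 2 ^ w = 2 := Nat.mod_eq_of_lt (hl.lt_word (by norm_num))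
    -- The leaf and tree equations, corrected by the amount still to be added to node `v`. They are
    -- those of `DynRep` once `v` has moved up from the leaf to `0`, which is not a node.
    let E : (ℕ → ℕ) → ℕ → (ℕ → ℕ → ZMod (2 ^ w)) → Prop := fun mem v f =>
      (∀ j' < n, ∀ c' < L, (mem (cell n m L (n + (n + j')) c') : ZMod (2 ^ w)) +
        (if n + j' = v ∧ c' = c then (d : ZMod (2 ^ w)) else 0) = f j' c') ∧
      ∀ u, 1 ≤ u → u < n → ∀ c' < L, (mem (cell n m L (n + u) c') : ZMod (2 ^ w)) +
        (if u = v ∧ c' = c then (d : ZMod (2 ^ w)) else 0) =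
        mem (cell n m L (n + 2 * u) c') + mem (cell n m L (n + (2 * u + 1)) c')
    let I : ℕ → Config → Prop := fun f s' => (∀ r < 22, s'.reg r = s.reg r) ∧
      (∀ a < m + 2 * n + n * L, s'.mem a = s.mem a) ∧ s'.reg 24 < 2 ^ f ∧ s'.reg 24 < 2 * n ∧
      ∀ f, DynRep n m L w .textOnly s.mem f → E s'.mem (s'.reg 24)
        fun j' c' => f j' c' + if j' = j ∧ c' = c then (d : ZMod (2 ^ w)) else 0
    refine Runs.op_seq ?_
    have hnj : (n + j) % 2 ^ w = n + j := Nat.mod_eq_of_lt (by omega)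
    refine (Runs.while I ?_ (Nat.log 2 n + 2) _ ?_).mono le_rfl ?_
    · rintro f s₁ ⟨hr, hm, hpow, hv, hE⟩ hx
      rw [Operand.val_reg] at hx
      have hf1 : Frame n m k L K s₁ := hf.congr fun r _ hr' => hr r (by omega)
      have hc1 : s₁.reg 20 = c := by rw [hr 20 (by norm_num), hc]
      have hd1 : s₁.reg 21 = d := by rw [hr 21 (by norm_num), hd]
      obtain ⟨v, hvdef⟩ : ∃ v, s₁.reg 24 = v := ⟨_, rfl⟩
      rw [hvdef] at hpow hv hx hE
      have hcell := hl.dynCell_word (r := v) (by omega) hcL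
      have hlt := cell_lt (m := m) (show n + v < 4 * n by omega) hcL
      have hf0 : f ≠ 0 := by rintro rfl; simp at hpow; omega
      refine ⟨f - 1, by omega, ?_⟩
      refine Runs.op_seq (Runs.op_seq (Runs.op_seq (Runs.load_seq ?_ (Runs.op_seq
        (Runs.store_seq ?_ (Runs.op ?_))))))
      · simp only [BinOp.eval, Config.setReg_reg, Operand.val_reg, if_true, if_false,
          Nat.reduceEqDiff, hf1.dynRows, hf1.dim, hc1, hvdef, hcell]
        omega
      · simp only [BinOp.eval, Config.setReg_reg, Operand.val_reg, if_true, if_false,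
          Nat.reduceEqDiff, hf1.dynRows, hf1.dim, hc1, hvdef, hcell]
        omega
      · simp only [BinOp.eval, Config.setReg_reg, Operand.val_reg, Operand.val_const, if_true,
          if_false, Nat.reduceEqDiff, hf1.dynRows, hf1.dim, hc1, hvdef, hcell, Config.setReg_mem,
          hd1, Config.setMem_reg, Config.setMem_mem, h2, I]
        refine ⟨?_, ?_, ?_, ?_, ?_⟩
        · intro r hr'
          simp [show r ≠ 22 by omega, show r ≠ 23 by omega, show r ≠ 24 by omega, hr r hr']
        · intro a ha
          rw [Function.update_of_ne, hm a ha]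
          unfold cell
          rw [add_mul]
          omega
        · have : 2 ^ f = 2 * 2 ^ (f - 1) := by rw [← pow_succ']; congr 1; omega
          omega
        · omega
        · intro f hf'
          obtain ⟨hE1, hE2⟩ := hE f hf'
          refine ⟨?_, ?_⟩
          · intro j' hj' c' hc'
            rw [← hE1 j' hj' c' hc']
            simp only [Function.update_apply, cell_inj hc' hcL, Nat.add_left_cancel_iff]
            rw [if_neg (show ¬ (n + j' = v / 2 ∧ c' = c) by omega), add_zero]
            by_cases h : n + j' = v ∧ c' = c
            · rw [if_pos h, if_pos h]
              obtain ⟨rfl, rfl⟩ := h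
              simp
            · rw [if_neg h, if_neg h, add_zero]
          · intro u hu1 hu c' hc'
            have e := hE2 u hu1 hu c' hc'
            simp only [Function.update_apply, cell_inj hc' hcL, Nat.add_left_cancel_iff]
            by_cases hcc : c' = c
            · subst hcc
              simp only [and_true] at e ⊢
              by_cases h : u = v
              · subst h
                rw [if_pos rfl, if_neg (by omega), if_neg (by omega), if_neg (by omega), ← e]
                simp
              · rw [if_neg h, add_zero] at e
                rw [if_neg h]
                by_cases h3 : u = v / 2
                · rw [if_pos h3]
                  rcases Nat.mod_two_eq_zero_or_one v with h4 | h4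
                  · obtain rfl : 2 * u = v := by omega
                    rw [if_pos rfl, if_neg (by omega), e]
                    push_cast [ZMod.natCast_mod]
                    ring
                  · obtain rfl : 2 * u + 1 = v := by omega
                    rw [if_pos rfl, if_neg (by omega), e]
                    push_cast [ZMod.natCast_mod]
                    ring
                · rw [if_neg h3, if_neg (by omega), if_neg (by omega), add_zero, e]
            · simpa [hcc] using e
    · simp only [BinOp.eval, Config.setReg_reg, Operand.val_reg, if_true, Config.setReg_mem,
        hf.textLen, hj, I, hnj]
      refine ⟨?_, fun _ _ => trivial, ?_, by omega, ?_⟩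
      · intro r hr
        simp [show r ≠ 24 by omega]
      · have := lt_two_pow_log_add_two (n := n)
        omega
      · rintro f ⟨hf1, hf2⟩
        refine ⟨?_, ?_⟩
        · intro j' hj' c' hc'
          rw [hf1 j' hj' c' hc']
          simp
        · intro u hu1 hu c' hc'
          rw [hf2 u hu1 hu c' hc', if_neg (by omega), add_zero]
    · rintro s' ⟨hx, g, hr, hm, -, -, hE⟩
      rw [Operand.val_reg] at hx
      refine ⟨fun r hr' => hr r (by omega), hm, fun f hf' => ?_⟩
      obtain ⟨h1, h2⟩ := hE f hf'
      rw [hx] at h1 h2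
      refine ⟨fun j' hj' c' hc' => ?_, fun v hv1 hv c' hc' => ?_⟩
      · rw [← h1 j' hj' c' hc', if_neg (by omega), add_zero]
      · rw [← h2 v hv1 hv c' hc', if_neg (by omega), add_zero]

/-! ### Reading a sketch of the updatable string -/

theorem sum_Ico_two_mul {R : Type*} [CommRing R] {t : ℕ → R} {n : ℕ}
    (ht : ∀ u, 1 ≤ u → u < n → t u = t (2 * u) + t (2 * u + 1)) {a b : ℕ} (ha : 1 ≤ a)
    (hab : a ≤ b) (hb : b ≤ n) :
    ∑ u ∈ Finset.Ico (2 * a) (2 * b), t u = ∑ u ∈ Finset.Ico a b, t u := by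
  induction b, hab using Nat.le_induction with
  | base => simp
  | succ b hab ih =>
    rw [Finset.sum_Ico_succ_top hab, ← ih (by omega), ht b (by omega) (by omega), mul_add, mul_one,
      Finset.sum_Ico_succ_top (by omega), Finset.sum_Ico_succ_top (by omega)]
    ring

/-- One round of the bottom-up range query in a segment tree: split off the two end nodes that are
not the left, respectively the right, half of a sibling pair inside the range, and move up. -/
theorem sum_Ico_tree {R : Type*} [CommRing R] {t : ℕ → R} {n : ℕ}
    (ht : ∀ u, 1 ≤ u → u < n → t u = t (2 * u) + t (2 * u + 1)) {l r : ℕ} (hl : 1 ≤ l)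
    (hlr : l < r) (hr : r ≤ 2 * n) :
    ∑ u ∈ Finset.Ico l r, t u = t l * (l % 2 : ℕ) + t (r - r % 2) * (r % 2 : ℕ) +
      ∑ u ∈ Finset.Ico ((l + l % 2) / 2) ((r - r % 2) / 2), t u := by
  have h1 : ∑ u ∈ Finset.Ico l r, t u =
      t l * (l % 2 : ℕ) + ∑ u ∈ Finset.Ico (l + l % 2) r, t u := by
    rcases Nat.mod_two_eq_zero_or_one l with h | h
    · simp [h]
    · rw [Finset.sum_eq_sum_Ico_succ_bot hlr, h]; simp
  have h2 : ∑ u ∈ Finset.Ico (l + l % 2) r, t u =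
      t (r - r % 2) * (r % 2 : ℕ) + ∑ u ∈ Finset.Ico (l + l % 2) (r - r % 2), t u := by
    rcases Nat.mod_two_eq_zero_or_one r with h | h
    · simp [h]
    · obtain ⟨r, rfl⟩ : ∃ r', r = r' + 1 := ⟨r - 1, by omega⟩
      rw [Finset.sum_Ico_succ_top (by omega), h]
      simp [add_comm]
  rw [← sum_Ico_two_mul ht (a := (l + l % 2) / 2) (b := (r - r % 2) / 2) (by omega) (by omega)
      (by omega),
    show 2 * ((l + l % 2) / 2) = l + l % 2 by omega,
    show 2 * ((r - r % 2) / 2) = r - r % 2 by omega, h1, h2]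
  ring

/-- Add the coordinate in register 20 of the tree node in register `v`, multiplied by register 27, to
register 25. -/
def addNode (v : ℕ) : Prog :=
  op .mul 22 (reg v) (reg 6) ;; op .add 22 (reg 22) (reg 9) ;; op .add 22 (reg 22) (reg 20) ;;
  load 22 (reg 22) ;; op .mul 22 (reg 22) (reg 27) ;; op .add 25 (reg 25) (reg 22)

theorem runs_addNode {q n m k L K w S : ℕ} (hl : Layout q n m k L K w S) (ω : ℕ → Fin (2 ^ w))
    {s : Config} (hf : Frame n m k L K s) {v u c : ℕ} (hv : s.reg v = u)
    (hu : u < 3 * n) (hc : s.reg 20 = c) (hcL : c < L) :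
    Runs w S ω (addNode v) s 6 fun s' => (∀ r, r ≠ 22 → r ≠ 25 → s'.reg r = s.reg r) ∧
      s'.mem = s.mem ∧ (s'.reg 25 : ZMod (2 ^ w)) =
        s.reg 25 + s.mem (cell n m L (n + u) c) * s.reg 27 := by
  have hspace := hl.space
  have hcell := hl.dynCell_word hu hcL
  have hlt := cell_lt (m := m) (show n + u < 4 * n by omega) hcL
  refine Runs.op_seq (Runs.op_seq (Runs.op_seq (Runs.load_seq ?_ (Runs.op_seq (Runs.op ?_)))))
  · simp only [BinOp.eval, Config.setReg_reg, Operand.val_reg, if_true, if_false,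
      Nat.reduceEqDiff, hf.dynRows, hf.dim, hc, hv, hcell]
    omega
  · simp only [BinOp.eval, Config.setReg_reg, Operand.val_reg, if_true, if_false,
      Nat.reduceEqDiff, hf.dynRows, hf.dim, hc, hv, hcell, Config.setReg_mem]
    refine ⟨?_, trivial, ?_⟩
    · intro r h1 h2
      simp [h1, h2]
    · push_cast [ZMod.natCast_mod]
      rfl

/-- Compute the coordinate in register 20 of the current sketch of the updatable string under the
alignment in register 0; the result goes to register 25. In the segment tree, registers 23 and 24
delimit the range of nodes still to be summed, and multiplying by a parity replaces a branch. -/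
def readDyn : Mode → Prog
  | .patternOnly => op .add 22 (reg 9) (reg 20) ;; load 25 (reg 22)
  | .textOnly =>
    op .add 23 (reg 0) (reg 3) ;; op .add 24 (reg 23) (reg 4) ;; op .add 25 (const 0) (const 0) ;;
    op .lt 26 (reg 23) (reg 24) ;;
    whileNZ (reg 26) (
      op .mod 27 (reg 23) (const 2) ;; addNode 23 ;; op .add 23 (reg 23) (reg 27) ;;
      op .mod 27 (reg 24) (const 2) ;; op .sub 24 (reg 24) (reg 27) ;; addNode 24 ;;
      op .div 23 (reg 23) (const 2) ;; op .div 24 (reg 24) (const 2) ;;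
      op .lt 26 (reg 23) (reg 24))

/-- The number of steps allowed for `readDyn`. -/
def readDynTime (n : ℕ) : Mode → ℕ
  | .patternOnly => 2
  | .textOnly => 4 + ((Nat.log 2 n + 2) * (19 + 1) + 1)

/-- The position by which the `j`-th letters of both strings are hashed under alignment `i`: the
position in the updatable string. -/
def hashPos : Mode → ℕ → ℕ → ℕ
  | .patternOnly, _, j => j
  | .textOnly, i, j => i + j

theorem runs_readDyn {q n m k L K w S : ℕ} (hl : Layout q n m k L K w S) (ω : ℕ → Fin (2 ^ w))
    (M : Mode) {s : Config} (hf : Frame n m k L K s) {i c : ℕ} (hi : s.reg 0 = i)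
    (him : i + m ≤ n) (hc : s.reg 20 = c) (hcL : c < L) :
    Runs w S ω (readDyn M) s (readDynTime n M) fun s' => (∀ r < 22, s'.reg r = s.reg r) ∧
      s'.mem = s.mem ∧ ∀ f, DynRep n m L w M s.mem f →
        (s'.reg 25 : ZMod (2 ^ w)) = ∑ j ∈ Finset.range m, f (hashPos M i j) c := by
  have hword := hl.word
  have hspace := hl.space
  have hm := hl.one_le_m
  have hL := hl.L_le
  cases M with
  | patternOnly =>
    have hcell := hl.dynCell_word (r := 0) (by omega) hcL
    simp only [zero_mul, Nat.zero_mod, zero_add, add_zero] at hcell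
    rw [Nat.mod_add_mod] at hcell
    have hlt := cell_lt (m := m) (show n < 4 * n by omega) hcL
    refine Runs.op_seq (Runs.load ?_ ?_)
    · simp [BinOp.eval, hf.dynRows, hc, hcell]; omega
    · simp only [BinOp.eval, Config.setReg_reg, Operand.val_reg, if_true,
        hf.dynRows, hc, hcell, Config.setReg_mem]
      refine ⟨?_, trivial, ?_⟩
      · intro r hr
        simp [show r ≠ 22 by omega, show r ≠ 25 by omega]
      · intro f hf'
        exact hf' c hcL
  | textOnly =>
    have h2 : 2 % 2 ^ w = 2 := Nat.mod_eq_of_lt (hl.lt_word (by norm_num))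
    let t : ℕ → ZMod (2 ^ w) := fun v => s.mem (cell n m L (n + v) c)
    -- The accumulated sum plus the sum over the remaining range of nodes is constant.
    let I : ℕ → Config → Prop := fun f s' => (∀ r < 22, s'.reg r = s.reg r) ∧ s'.mem = s.mem ∧
      s'.reg 24 < 2 ^ f ∧ 1 ≤ s'.reg 23 ∧ s'.reg 23 ≤ s'.reg 24 ∧ s'.reg 24 ≤ 2 * n ∧
      s'.reg 26 = (if s'.reg 23 < s'.reg 24 then 1 else 0) ∧
      ((∀ u, 1 ≤ u → u < n → t u = t (2 * u) + t (2 * u + 1)) →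
        (s'.reg 25 : ZMod (2 ^ w)) + ∑ u ∈ Finset.Ico (s'.reg 23) (s'.reg 24), t u =
          ∑ u ∈ Finset.Ico (n + i) (n + i + m), t u)
    have hlin : (i + n) % 2 ^ w = n + i := by rw [Nat.mod_eq_of_lt] <;> omega
    have hrin : (n + i + m) % 2 ^ w = n + i + m := Nat.mod_eq_of_lt (by omega)
    refine Runs.mono (T₁ := 1 + (1 + (1 + (1 + ((Nat.log 2 n + 2) * (19 + 1) + 1)))))
      (Runs.op_seq (Runs.op_seq (Runs.op_seq (Runs.op_seq ?_))))
      (by simp only [readDynTime]; omega) fun _ h => h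
    refine (Runs.while I ?_ (Nat.log 2 n + 2) _ ?_).mono le_rfl ?_
    · rintro f s₁ ⟨hr, hmem, hpow, hl1, hle, hr2, h26, hsum⟩ hx
      obtain ⟨l, hldef⟩ : ∃ v, s₁.reg 23 = v := ⟨_, rfl⟩
      obtain ⟨r, hrdef⟩ : ∃ v, s₁.reg 24 = v := ⟨_, rfl⟩
      rw [Operand.val_reg, h26] at hx
      rw [hldef, hrdef] at hx hsum hle
      rw [hldef] at hl1
      rw [hrdef] at hpow hr2
      have hlr : l < r := by by_contra h; simp [h] at hx
      have hf0 : f ≠ 0 := by rintro rfl; simp at hpow; omega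
      have hpow' : 2 ^ f = 2 * 2 ^ (f - 1) := by rw [← pow_succ']; congr 1; omega
      have hll : (l + l % 2) % 2 ^ w = l + l % 2 := Nat.mod_eq_of_lt (by omega)
      have hrr : (r + (2 ^ w - r % 2)) % 2 ^ w = r - r % 2 := by
        rw [show r + (2 ^ w - r % 2) = (r - r % 2) + 2 ^ w by omega, Nat.add_mod_right]
        exact Nat.mod_eq_of_lt (by omega)
      have hf1 : Frame n m k L K s₁ := hf.congr fun r _ hr' => hr r (by omega)
      have hc1 : s₁.reg 20 = c := by rw [hr 20 (by norm_num), hc]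
      refine ⟨f - 1, by omega, ?_⟩
      refine Runs.mono (T₁ := 1 + (6 + (1 + (1 + (1 + (6 + (1 + (1 + 1))))))))
        (Q := I (f - 1)) ?_ (by norm_num) fun _ h => h
      refine Runs.op_seq (Runs.seq (runs_addNode hl ω (u := l) (c := c) ?_ ?_ (by omega) ?_ hcL) ?_)
      · refine hf1.congr fun r _ hr' => ?_
        simp [show r ≠ 27 by omega]
      · simp [hldef]
      · simp [hc1]
      rintro s₂ ⟨hr2', hm2, h25⟩
      simp only [BinOp.eval, Config.setReg_reg, Operand.val_reg, Operand.val_const, if_true,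
        if_false, Nat.reduceEqDiff, Config.setReg_mem, h2, hldef] at hr2' hm2 h25
      have e23 := hr2' 23 (by norm_num) (by norm_num)
      have e24 := hr2' 24 (by norm_num) (by norm_num)
      have e27 := hr2' 27 (by norm_num) (by norm_num)
      have e20 := hr2' 20 (by norm_num) (by norm_num)
      simp only [if_true, if_false, Nat.reduceEqDiff, hldef, hrdef, hc1] at e23 e24 e27 e20
      have hf2 : Frame n m k L K s₂ := hf1.congr fun r _ hr' => by
        rw [hr2' r (by omega) (by omega), if_neg (by omega)]
      refine Runs.op_seq (Runs.op_seq (Runs.op_seq (Runs.seq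
        (runs_addNode hl ω (u := r - r % 2) (c := c) ?_ ?_ (by omega) ?_ hcL) ?_)))
      · refine hf2.congr fun r _ hr' => ?_
        simp [show r ≠ 27 by omega, show r ≠ 23 by omega, show r ≠ 24 by omega]
      · simp [BinOp.eval, e24, h2, hrr]
      · simp [e20]
      rintro s₃ ⟨hr3, hm3, h25'⟩
      simp only [BinOp.eval, Config.setReg_reg, Operand.val_reg, Operand.val_const, if_true,
        if_false, Nat.reduceEqDiff, Config.setReg_mem, h2, e23, e24, e27, hll, hrr] at hr3 hm3 h25'
      have g23 := hr3 23 (by norm_num) (by norm_num)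
      have g24 := hr3 24 (by norm_num) (by norm_num)
      simp only [if_true, if_false, Nat.reduceEqDiff] at g23 g24
      refine Runs.op_seq (Runs.op_seq (Runs.op ?_))
      simp only [I, BinOp.eval, Config.setReg_reg, Operand.val_reg, Operand.val_const, if_true,
        if_false, Nat.reduceEqDiff, Config.setReg_mem, h2, g23, g24, true_and]
      refine ⟨?_, ?_, ?_, ?_, ?_, ?_, ?_⟩
      · intro r hr'
        rw [if_neg (by omega), if_neg (by omega), if_neg (by omega), hr3 r (by omega) (by omega),
          if_neg (by omega), if_neg (by omega), if_neg (by omega), hr2' r (by omega) (by omega),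
          if_neg (by omega), hr r hr']
      · rw [hm3, hm2, hmem]
      · omega
      · omega
      · omega
      · omega
      · intro ht
        have hstep := sum_Ico_tree ht hl1 hlr hr2
        rw [← hsum ht, hstep, h25', h25, hm2, hmem]
        ring
    · simp only [BinOp.eval, Config.setReg_reg, Operand.val_reg, Operand.val_const, if_true,
        if_false, Nat.reduceEqDiff, Config.setReg_mem, hf.textLen, hf.patternLen, hi, I, hlin,
        hrin, true_and, Nat.zero_mod, Nat.cast_zero, zero_add]
      refine ⟨?_, ?_, by omega, by omega, by omega, fun _ => trivial⟩
      · intro r hr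
        simp [show r ≠ 23 by omega, show r ≠ 24 by omega, show r ≠ 25 by omega,
          show r ≠ 26 by omega]
      · have := lt_two_pow_log_add_two (n := n)
        omega
    · rintro s' ⟨hx, g, hr, hmem, -, -, -, -, h26, hsum⟩
      rw [Operand.val_reg, h26] at hx
      have hlr : s'.reg 24 ≤ s'.reg 23 := by by_contra h; simp [not_le.mp h] at hx
      refine ⟨hr, hmem, fun f hf' => ?_⟩
      have h := hsum fun u hu1 hu => hf'.2 u hu1 hu c hcL
      rw [Finset.Ico_eq_empty_of_le hlr, Finset.sum_empty, add_zero] at h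
      rw [h, Finset.sum_Ico_eq_sum_range, Nat.add_sub_cancel_left]
      refine Finset.sum_congr rfl fun j hj => ?_
      change t (n + i + j) = f (i + j) c
      rw [← hf'.1 (i + j) (by rw [Finset.mem_range] at hj; omega) c hcL]
      simp only [t, add_assoc]

/-! ### The invariant, queries and updates -/

/-- The address of the first letter of the updatable string. -/
def dynBase (m : ℕ) : Mode → ℕ
  | .patternOnly => 0
  | .textOnly => m

/-- The address of the `j`-th letter of the fixed string under alignment `i`. -/
def fixedAddr (m : ℕ) : Mode → ℕ → ℕ → ℕ
  | .patternOnly, i, j => m + (i + j)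
  | .textOnly, _, j => j

/-- The contributions of the letters of the updatable string to its sketches. -/
def dynContribution (n m k w : ℕ) (M : Mode) (ω : ℕ → Fin (2 ^ w)) (X : ℕ → ℕ) (j c : ℕ) :
    ZMod (2 ^ w) :=
  if j < M.len n m then (contribution k (ω j) (X (dynBase m M + j)) c : ℤ) else 0

/-- Coordinate `c` of the sketch of the fixed string under alignment `i`. -/
def fixedSketch (m k w : ℕ) (M : Mode) (ω : ℕ → Fin (2 ^ w)) (X : ℕ → ℕ) (i c : ℕ) :
    ZMod (2 ^ w) :=
  ∑ j ∈ Finset.range m, (contribution k (ω (hashPos M i j)) (X (fixedAddr m M i j)) c : ℤ)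

/-- The invariant of the data structure: `X` is the pattern followed by the text. The sketches of
the fixed string are stored with a minus sign. -/
structure Inv (n m k L K w : ℕ) (M : Mode) (ω : ℕ → Fin (2 ^ w)) (X : ℕ → ℕ) (s : Config) :
    Prop where
  frame : Frame n m k L K s
  strings : ∀ a < m + n, s.mem a = X a
  words : ∀ p < n, s.mem (m + n + p) = ω p
  fixed : ∀ i, i + m ≤ n → ∀ c < L,
    (s.mem (cell n m L i c) : ZMod (2 ^ w)) = -fixedSketch m k w M ω X i c
  dyn : DynRep n m L w M s.mem (dynContribution n m k w M ω X)

theorem Inv.congr {n m k L K w : ℕ} {M : Mode} {ω : ℕ → Fin (2 ^ w)} {X : ℕ → ℕ} {s s' : Config}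
    (h : Inv n m k L K w M ω X s) (hr : ∀ r, 2 ≤ r → r < 10 → s'.reg r = s.reg r)
    (hm : s'.mem = s.mem) : Inv n m k L K w M ω X s' where
  frame := h.frame.congr hr
  strings := by rw [hm]; exact h.strings
  words := by rw [hm]; exact h.words
  fixed := by rw [hm]; exact h.fixed
  dyn := by rw [hm]; exact h.dyn

/-- The query program: the squared distance of the two sketches, accumulated in register 15, is
scaled by `3 K / (2 (3 K - 1))`. -/
def query (M : Mode) : Prog :=
  op .add 15 (const 0) (const 0) ;; op .add 20 (reg 6) (const 0) ;;
  whileNZ (reg 20) (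
    op .sub 20 (reg 20) (const 1) ;; readDyn M ;;
    op .mul 22 (reg 0) (reg 6) ;; op .add 22 (reg 22) (reg 8) ;; op .add 22 (reg 22) (reg 20) ;;
    load 22 (reg 22) ;; op .add 25 (reg 25) (reg 22) ;; op .mul 25 (reg 25) (reg 25) ;;
    op .add 15 (reg 15) (reg 25)) ;;
  op .mul 22 (reg 2) (const 3) ;; op .mul 15 (reg 15) (reg 22) ;; op .sub 22 (reg 22) (const 1) ;;
  op .mul 22 (reg 22) (const 2) ;; op .div 0 (reg 15) (reg 22)

/-- The squared distance of the sketches, as computed in word arithmetic. -/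
def wordEstimate (n m k L w : ℕ) (M : Mode) (ω : ℕ → Fin (2 ^ w)) (X : ℕ → ℕ) (i : ℕ) :
    ZMod (2 ^ w) :=
  ∑ c ∈ Finset.range L, (∑ j ∈ Finset.range m, dynContribution n m k w M ω X (hashPos M i j) c -
    fixedSketch m k w M ω X i c) ^ 2

theorem runs_query {q n m k L K w S : ℕ} (hl : Layout q n m k L K w S) (ω : ℕ → Fin (2 ^ w))
    (M : Mode) {X : ℕ → ℕ} {s : Config} (hs : Inv n m k L K w M ω X s) {i : ℕ}
    (hi : s.reg 0 = i) (him : i + m ≤ n) :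
    Runs w S ω (query M) s (2 + (L * (readDynTime n M + 8 + 1) + 1) + 5) fun s' =>
      Inv n m k L K w M ω X s' ∧
      s'.reg 0 = (wordEstimate n m k L w M ω X i).val * (3 * K) % 2 ^ w / (2 * (3 * K - 1)) := by
  have hword := hl.word
  have hspace := hl.space
  have hm := hl.one_le_m
  have hLn := hl.L_le
  have hkL := hl.k_le_L
  have hbuck := hl.buckets
  have hK := hl.one_le_K
  have h1 : 1 % 2 ^ w = 1 := Nat.mod_eq_of_lt (hl.lt_word (by norm_num))
  have h2 : 2 % 2 ^ w = 2 := Nat.mod_eq_of_lt (hl.lt_word (by norm_num))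
  have h3 : 3 % 2 ^ w = 3 := Nat.mod_eq_of_lt (hl.lt_word (by norm_num))
  have hpos : 0 < 2 ^ w := by positivity
  let e : ℕ → ZMod (2 ^ w) := fun c =>
    (∑ j ∈ Finset.range m, dynContribution n m k w M ω X (hashPos M i j) c -
      fixedSketch m k w M ω X i c) ^ 2
  let I : ℕ → Config → Prop := fun f s' => (∀ r < 10, s'.reg r = s.reg r) ∧ s'.mem = s.mem ∧
    s'.reg 20 = f ∧ f ≤ L ∧ s'.reg 15 < 2 ^ w ∧
    (s'.reg 15 : ZMod (2 ^ w)) = ∑ c ∈ Finset.Ico f L, e c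
  have hLmod : L % 2 ^ w = L := Nat.mod_eq_of_lt (by omega)
  refine Runs.mono (T₁ := 1 + (1 + ((L * (readDynTime n M + 8 + 1) + 1) + (1 + (1 + (1 + (1 + 1)))))))
    (Runs.op_seq (Runs.op_seq (Runs.seq (Runs.while I ?_ L _ ?_) ?_))) (by omega) fun _ h => h
  · rintro f s₁ ⟨hr, hmem, h20, hfL, -, hacc⟩ hx
    rw [Operand.val_reg, h20] at hx
    obtain ⟨f, rfl⟩ : ∃ f', f = f' + 1 := ⟨f - 1, by omega⟩
    refine ⟨f, rfl, ?_⟩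
    have hff : (f + 1 + (2 ^ w - 1)) % 2 ^ w = f := by
      rw [show f + 1 + (2 ^ w - 1) = f + 2 ^ w by omega, Nat.add_mod_right]
      exact Nat.mod_eq_of_lt (by omega)
    have hf1 : Frame n m k L K s₁ := hs.frame.congr fun r _ hr' => hr r hr'
    refine Runs.mono (T₁ := 1 + (readDynTime n M + (1 + (1 + (1 + (1 + (1 + (1 + 1))))))))
      (Q := I f) ?_ (by omega) fun _ h => h
    refine Runs.op_seq (Runs.seq (runs_readDyn hl ω M (i := i) (c := f) ?_ ?_ him ?_ hfL) ?_)
    · exact hf1.congr fun r _ hr' => by simp [show r ≠ 20 by omega]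
    · simp [hr 0, hi]
    · simp [BinOp.eval, h20, h1, hff]
    rintro s₂ ⟨hr2, hm2, h25⟩
    simp only [BinOp.eval, Config.setReg_reg, Operand.val_reg, Operand.val_const, h20, h1,
      hff, Config.setReg_mem] at hr2 hm2 h25
    have e0 := hr2 0 (by norm_num)
    have e6 := hr2 6 (by norm_num)
    have e8 := hr2 8 (by norm_num)
    have e15 := hr2 15 (by norm_num)
    have e20 := hr2 20 (by norm_num)
    simp only [if_true, if_false, Nat.reduceEqDiff, hf1.dim, hf1.rows] at e0 e6 e8 e15 e20
    rw [hr 0 (by norm_num), hi] at e0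
    have hcell := hl.cell_word (r := i) (by omega) hfL
    have hlt := cell_lt (m := m) (show i < 4 * n by omega) hfL
    refine Runs.op_seq (Runs.op_seq (Runs.op_seq (Runs.load_seq ?_ (Runs.op_seq
      (Runs.op_seq (Runs.op ?_))))))
    · simp only [BinOp.eval, Config.setReg_reg, Operand.val_reg, if_true, if_false,
        Nat.reduceEqDiff, e0, e6, e8, e20, hcell]
      omega
    · simp only [I, BinOp.eval, Config.setReg_reg, Operand.val_reg, if_true, if_false,
        Nat.reduceEqDiff, e0, e6, e8, e15, e20, hcell, Config.setReg_mem, hm2, hmem, true_and]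
      refine ⟨?_, by omega, Nat.mod_lt _ hpos, ?_⟩
      · intro r hr'
        rw [if_neg (by omega), if_neg (by omega), if_neg (by omega), if_neg (by omega),
          if_neg (by omega), if_neg (by omega), if_neg (by omega), hr2 r (by omega),
          if_neg (by omega), hr r hr']
      · rw [Finset.sum_eq_sum_Ico_succ_bot hfL, ← hacc]
        push_cast [ZMod.natCast_mod]
        rw [h25 _ (by rw [hmem]; exact hs.dyn), hs.fixed i him f hfL]
        simp only [e]
        ring
  · simp only [I, BinOp.eval, Config.setReg_reg, Operand.val_reg, Operand.val_const, if_true,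
      if_false, Nat.reduceEqDiff, Config.setReg_mem, Nat.zero_mod, add_zero, hs.frame.dim, hLmod,
      true_and]
    refine ⟨?_, le_rfl, hpos, by simp⟩
    intro r hr
    simp [show r ≠ 15 by omega, show r ≠ 20 by omega]
  · rintro s₁ ⟨hx, g, hr, hmem, h20, -, h15, hacc⟩
    rw [Operand.val_reg, h20] at hx
    subst hx
    have hval : s₁.reg 15 = (wordEstimate n m k L w M ω X i).val := by
      rw [← ZMod.val_cast_of_lt h15, hacc]
      simp only [wordEstimate, e, Finset.range_eq_Ico]
    have e2 : s₁.reg 2 = K := by rw [hr 2 (by norm_num), hs.frame.accuracy]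
    have hK3 : K * 3 % 2 ^ w = K * 3 := Nat.mod_eq_of_lt (by omega)
    have hK31 : (K * 3 + (2 ^ w - 1)) % 2 ^ w = K * 3 - 1 := by
      rw [show K * 3 + (2 ^ w - 1) = (K * 3 - 1) + 2 ^ w by omega, Nat.add_mod_right]
      exact Nat.mod_eq_of_lt (by omega)
    have hK32 : (K * 3 - 1) * 2 % 2 ^ w = (K * 3 - 1) * 2 := Nat.mod_eq_of_lt (by omega)
    refine Runs.op_seq (Runs.op_seq (Runs.op_seq (Runs.op_seq (Runs.op ?_))))
    simp only [BinOp.eval, Config.setReg_reg, Operand.val_reg, Operand.val_const, if_true,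
      if_false, Nat.reduceEqDiff, e2, hval, h1, h2, h3, hK3, hK31, hK32]
    refine ⟨?_, by rw [mul_comm K, mul_comm 2]⟩
    refine hs.congr (fun r hr1 hr2 => ?_) (by simpa using hmem)
    simp [show r ≠ 0 by omega, show r ≠ 15 by omega, show r ≠ 22 by omega, hr r hr2]

/-- The operand holding the address of the first letter of the updatable string. -/
def dynBaseOperand : Mode → Operand
  | .patternOnly => const 0
  | .textOnly => reg 4

/-- The update program: withdraw the contribution of the old letter, add that of the new one. The
sketches of the fixed string are not touched. -/
def update (M : Mode) : Prog :=
  op .add 18 (reg 0) (dynBaseOperand M) ;; op .add 16 (reg 0) (const 0) ;; load 17 (reg 18) ;;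
  store (reg 18) (reg 1) ;; hashAt ;; op .sub 21 (const 0) (reg 21) ;; addDyn M ;;
  op .add 17 (reg 1) (const 0) ;; hashAt ;; addDyn M

theorem Frame.val_dynBaseOperand {n m k L K w : ℕ} {s : Config} (hf : Frame n m k L K s)
    (M : Mode) : (dynBaseOperand M).val w s = dynBase m M := by
  cases M <;> simp [dynBaseOperand, dynBase, hf.patternLen]

theorem dynBase_add_lt {n m j : ℕ} {M : Mode} (hj : j < M.len n m) : dynBase m M + j < m + n := by
  cases M <;> simp only [Mode.len, dynBase] at * <;> omega

theorem fixedAddr_ne {n m i j j' : ℕ} {M : Mode} (hj : j < M.len n m) (hj' : j' < m) :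
    fixedAddr m M i j' ≠ dynBase m M + j := by
  cases M <;> simp only [Mode.len, dynBase, fixedAddr] at * <;> omega

theorem cast_contribution (k v a c w : ℕ) : ((contribution k v a c : ℤ) : ZMod (2 ^ w)) =
    if c = a * k + wordBucket k v then ((wordSign v : ℤ) : ZMod (2 ^ w)) else 0 := by
  unfold contribution
  split_ifs <;> simp

theorem runs_update {q n m k L K w S : ℕ} (hl : Layout q n m k L K w S) (ω : ℕ → Fin (2 ^ w))
    (M : Mode) {X : ℕ → ℕ} (hX : ∀ a < m + n, X a < q) {s : Config}
    (hs : Inv n m k L K w M ω X s) {j a : ℕ} (hj : s.reg 0 = j) (hjn : j < M.len n m)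
    (ha : s.reg 1 = a) (haq : a < q) :
    Runs w S ω (update M) s (24 + 2 * addDynTime n M)
      (Inv n m k L K w M ω (Function.update X (dynBase m M + j) a)) := by
  have hword := hl.word
  have hspace := hl.space
  have hm := hl.one_le_m
  have hLn := hl.L_le
  have hkL := hl.k_le_L
  have hk := hl.one_le_k
  have hjn' : j < n := hjn.trans_le (Mode.len_le hl.m_le_n M)
  have haddr := dynBase_add_lt hjn
  set D := dynBase m M + j with hD
  have hDmod : (j + dynBase m M) % 2 ^ w = D := by
    rw [Nat.mod_eq_of_lt (by omega), add_comm]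
  have hjmod : j % 2 ^ w = j := Nat.mod_eq_of_lt (by omega)
  have hqL : q ≤ L := by rw [hl.dim]; exact Nat.le_mul_of_pos_right _ hk
  have hamod : a % 2 ^ w = a := Nat.mod_eq_of_lt (by omega)
  have hcL : ∀ b < q, b * k + wordBucket k (ω j) < L := fun b hb => by
    rw [hl.dim]; exact coord_lt hb (wordBucket_lt hk _)
  refine Runs.mono (T₁ := 1 + (1 + (1 + (1 + (9 + (1 + (addDynTime n M + (1 + (9 +
    addDynTime n M))))))))) ?_ (by omega) fun _ h => h
  refine Runs.op_seq (Runs.op_seq (Runs.load_seq ?_ (Runs.store_seq ?_ (Runs.seq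
    (runs_hashAt hl ω (p := j) (a := X D) (v := ω j) ?_ ?_ hjn' ?_ (hX D haddr) ?_) ?_))))
  · simp [BinOp.eval, hs.frame.val_dynBaseOperand, hj, hDmod]; omega
  · simp [BinOp.eval, hs.frame.val_dynBaseOperand, hj, hDmod]; omega
  · exact hs.frame.congr fun r _ hr => by
      simp [show r ≠ 16 by omega, show r ≠ 17 by omega, show r ≠ 18 by omega]
  · simp [BinOp.eval, hj, hjmod]
  · simp [BinOp.eval, hs.frame.val_dynBaseOperand, hj, hDmod, hs.strings D haddr]
  · simp only [BinOp.eval, Config.setReg_reg, Operand.val_reg, Operand.val_const, if_true,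
      if_false, Nat.reduceEqDiff, Config.setReg_mem, hs.frame.val_dynBaseOperand, hj, hDmod,
      Config.setMem_mem, Function.update_apply]
    rw [if_neg (by omega), hs.words j hjn']
  rintro s₁ ⟨hr1, hm1, hc1, hlt1, hd1⟩
  simp only [BinOp.eval, Config.setReg_reg, Operand.val_reg, Operand.val_const, if_true,
    if_false, Nat.reduceEqDiff, Config.setReg_mem, hs.frame.val_dynBaseOperand, hj, hDmod,
    Config.setMem_mem, Config.setMem_reg, hs.strings D haddr, Nat.zero_mod, add_zero, hjmod,
    OfNat.one_ne_ofNat, ha] at hr1 hm1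
  have hf1 : Frame n m k L K s₁ := hs.frame.congr fun r _ hr => by
    rw [hr1 r (by omega), if_neg (by omega), if_neg (by omega), if_neg (by omega)]
  have e1 : s₁.reg 1 = a := by rw [hr1 1 (by norm_num)]; simpa using ha
  have e16 : s₁.reg 16 = j := by rw [hr1 16 (by norm_num)]; simp
  refine Runs.op_seq (Runs.seq (runs_addDyn hl ω M (j := j)
    (c := X D * k + wordBucket k (ω j)) (hf1.congr fun r _ hr => ?_) ?_ hjn ?_
    (hcL _ (hX D haddr)) rfl) ?_)
  · simp [show r ≠ 21 by omega]
  · simp [e16]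
  · simp [hc1]
  rintro s₂ ⟨hr2, hm2, hdyn2⟩
  simp only [BinOp.eval, Config.setReg_reg, Operand.val_reg, Operand.val_const, if_true,
    Config.setReg_mem, Nat.zero_mod, cast_sub_word hlt1.le, hd1, Nat.cast_zero,
    zero_sub] at hr2 hm2 hdyn2
  have hf2 : Frame n m k L K s₂ := hf1.congr fun r _ hr => by
    rw [hr2 r (by omega), if_neg (by omega)]
  have f1 : s₂.reg 1 = a := by rw [hr2 1 (by norm_num)]; simpa using e1
  have f16 : s₂.reg 16 = j := by rw [hr2 16 (by norm_num)]; simpa using e16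
  have hm2' : ∀ b < m + 2 * n + n * L, s₂.mem b = Function.update s.mem D a b := fun b hb => by
    rw [hm2 b hb, hm1]
  refine Runs.op_seq (Runs.seq (runs_hashAt hl ω (p := j) (a := a) (v := ω j)
    (hf2.congr fun r _ hr => ?_) ?_ hjn' ?_ haq ?_) ?_)
  · simp [show r ≠ 17 by omega]
  · simp [f16]
  · simp [BinOp.eval, f1, hamod]
  · rw [Config.setReg_mem, hm2' _ (by omega), Function.update_of_ne (by omega), hs.words j hjn']
  rintro s₃ ⟨hr3, hm3, hc3, hlt3, hd3⟩
  simp only [BinOp.eval, Config.setReg_reg, Operand.val_reg, Operand.val_const,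
    Config.setReg_mem, Nat.zero_mod, add_zero, f1, hamod] at hr3 hm3
  have hf3 : Frame n m k L K s₃ := hf2.congr fun r _ hr => by
    rw [hr3 r (by omega), if_neg (by omega)]
  have g16 : s₃.reg 16 = j := by rw [hr3 16 (by norm_num)]; simpa using f16
  refine (runs_addDyn hl ω M (j := j) (c := a * k + wordBucket k (ω j)) hf3 g16 hjn hc3
    (hcL _ haq) rfl).mono le_rfl ?_
  rintro s₄ ⟨hr4, hm4, hdyn4⟩
  rw [hd3] at hdyn4
  rw [hm3] at hm4 hdyn4
  have hm4' : ∀ b < m + 2 * n + n * L, s₄.mem b = Function.update s.mem D a b := fun b hb => by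
    rw [hm4 b hb, hm2' b hb]
  refine ⟨hf3.congr fun r _ hr => hr4 r (by omega), ?_, ?_, ?_, ?_⟩
  · intro b hb
    rw [hm4' b (by omega)]
    simp only [Function.update_apply, hs.strings b hb]
  · intro p hp
    rw [hm4' _ (by omega), Function.update_of_ne (by omega), hs.words p hp]
  · intro i him c hc
    rw [hm4' _ (cell_lt_cell (by omega) hc), Function.update_of_ne (by unfold cell; omega),
      hs.fixed i him c hc]
    congr 1
    refine Finset.sum_congr rfl fun j' hj' => ?_
    rw [Function.update_of_ne (fixedAddr_ne hjn (Finset.mem_range.mp hj'))]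
  · have hstart : DynRep n m L w M s₁.mem (dynContribution n m k w M ω X) := by
      have hmem : ∀ v c, s₁.mem (cell n m L v c) = s.mem (cell n m L v c) := fun v c => by
        rw [hm1, Function.update_of_ne (by unfold cell; omega)]
      have := hs.dyn
      cases M <;> simpa only [DynRep, hmem] using this
    convert hdyn4 _ (hdyn2 _ hstart) using 1
    funext j' c'
    unfold dynContribution
    by_cases h : j' = j
    · subst h
      simp only [if_pos hjn, ← hD, Function.update_self, cast_contribution, true_and]
      split_ifs <;> ring
    · have hne : dynBase m M + j' ≠ D := by omega
      rw [Function.update_of_ne hne]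
      simp [h]

/-! ### Preprocessing -/

/-- Store a fresh random word for the position in register 10. -/
def drawWord : Prog := rand 22 ;; op .add 23 (reg 7) (reg 10) ;; store (reg 23) (reg 22)

/-- The operand holding `hashPos`. -/
def hashPosOperand : Mode → Operand
  | .patternOnly => reg 11
  | .textOnly => reg 18

/-- Compute `fixedAddr`. -/
def computeFixedAddr : Mode → Prog
  | .patternOnly => op .add 18 (reg 4) (reg 18)
  | .textOnly => op .add 18 (reg 11) (const 0)

/-- Subtract, from the sketch of the alignment in register 10, the contribution of the letter of the
fixed string that is paired with the pattern position in register 11. -/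
def addFixed (M : Mode) : Prog :=
  op .add 18 (reg 10) (reg 11) ;; op .add 16 (hashPosOperand M) (const 0) ;;
  computeFixedAddr M ;; load 17 (reg 18) ;; hashAt ;;
  op .mul 22 (reg 10) (reg 6) ;; op .add 22 (reg 22) (reg 8) ;; op .add 22 (reg 22) (reg 20) ;;
  load 23 (reg 22) ;; op .sub 23 (reg 23) (reg 21) ;; store (reg 22) (reg 23)

/-- Add the contribution of the letter of the updatable string at the position in register 10. -/
def addInitial (M : Mode) : Prog :=
  op .add 18 (reg 10) (dynBaseOperand M) ;; op .add 16 (reg 10) (const 0) ;; load 17 (reg 18) ;;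
  hashAt ;; addDyn M

/-- The register holding the length of the updatable string. -/
def lenReg : Mode → ℕ
  | .patternOnly => 4
  | .textOnly => 3

/-- The preprocessing: set up the registers, draw the random words, compute the sketches of the
fixed string under all alignments, and insert the letters of the updatable string. The number of
buckets is `C₀ * K ^ 2`. -/
def preprocess (q C₀ : ℕ) (M : Mode) : Prog :=
  op .add 3 (reg 0) (const 0) ;; op .add 4 (reg 1) (const 0) ;;
  op .mul 5 (reg 2) (reg 2) ;; op .mul 5 (reg 5) (const C₀) ;; op .mul 6 (const q) (reg 5) ;;
  op .add 7 (reg 4) (reg 3) ;; op .add 8 (reg 7) (reg 3) ;; op .mul 9 (reg 3) (reg 6) ;;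
  op .add 9 (reg 8) (reg 9) ;; op .sub 14 (reg 3) (reg 4) ;; op .add 14 (reg 14) (const 1) ;;
  forLoop 10 12 (reg 3) drawWord ;;
  forLoop 10 12 (reg 14) (forLoop 11 13 (reg 4) (addFixed M)) ;;
  forLoop 10 12 (reg (lenReg M)) (addInitial M)

theorem Frame.reg_lenReg {n m k L K : ℕ} {s : Config} (hf : Frame n m k L K s) (M : Mode) :
    s.reg (lenReg M) = M.len n m := by
  cases M <;> simp [lenReg, Mode.len, hf.patternLen, hf.textLen]

/-- The part of the invariant that does not concern the sketches. -/
structure Base (n m k L K w : ℕ) (ω : ℕ → Fin (2 ^ w)) (X : ℕ → ℕ) (s : Config) : Prop where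
  frame : Frame n m k L K s
  strings : ∀ a < m + n, s.mem a = X a
  words : ∀ p < n, s.mem (m + n + p) = ω p

theorem Base.congr {n m k L K w : ℕ} {ω : ℕ → Fin (2 ^ w)} {X : ℕ → ℕ} {s s' : Config}
    (h : Base n m k L K w ω X s) (hr : ∀ r, 2 ≤ r → r < 10 → s'.reg r = s.reg r)
    (hm : ∀ a < m + 2 * n, s'.mem a = s.mem a) : Base n m k L K w ω X s' where
  frame := h.frame.congr hr
  strings a ha := by rw [hm a (by omega), h.strings a ha]
  words p hp := by rw [hm _ (by omega), h.words p hp]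

theorem hashPos_lt {n m i j : ℕ} (him : i + m ≤ n) (hj : j < m) (M : Mode) : hashPos M i j < n := by
  cases M <;> simp only [hashPos] <;> omega

theorem fixedAddr_lt {n m i j : ℕ} (him : i + m ≤ n) (hj : j < m) (M : Mode) :
    fixedAddr m M i j < m + n := by
  cases M <;> simp only [fixedAddr] <;> omega

theorem runs_addFixed {q n m k L K w S : ℕ} (hl : Layout q n m k L K w S) (ω : ℕ → Fin (2 ^ w))
    (M : Mode) {X : ℕ → ℕ} (hX : ∀ a < m + n, X a < q) {s : Config}
    (hs : Base n m k L K w ω X s) {i j : ℕ} (hi : s.reg 10 = i) (him : i + m ≤ n)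
    (hj : s.reg 11 = j) (hjm : j < m) :
    Runs w S ω (addFixed M) s 19 fun s' => (∀ r < 16, s'.reg r = s.reg r) ∧
      (∀ a < m + 2 * n, s'.mem a = s.mem a) ∧
      (∀ i' c', c' < L → i' ≠ i → s'.mem (cell n m L i' c') = s.mem (cell n m L i' c')) ∧
      ∀ c' < L, (s'.mem (cell n m L i c') : ZMod (2 ^ w)) = s.mem (cell n m L i c') -
        (contribution k (ω (hashPos M i j)) (X (fixedAddr m M i j)) c' : ℤ) := by
  have hword := hl.word
  have hspace := hl.space
  have hLn := hl.L_le
  have hk := hl.one_le_k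
  have hp := hashPos_lt him hjm M
  have hadr := fixedAddr_lt him hjm M
  set p := hashPos M i j with hpdef
  set A := fixedAddr m M i j with hAdef
  have hij : (i + j) % 2 ^ w = i + j := Nat.mod_eq_of_lt (by omega)
  refine Runs.mono (T₁ := 1 + (1 + (1 + (1 + (9 + (1 + (1 + (1 + (1 + (1 + 1)))))))))) ?_
    (by norm_num) fun _ h => h
  refine Runs.op_seq (Runs.op_seq (Runs.seq (Q' := fun s' => (∀ r < 16, s'.reg r = s.reg r) ∧
    s'.mem = s.mem ∧ s'.reg 16 = p ∧ s'.reg 18 = A) ?_ ?_))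
  · cases M with
    | patternOnly =>
      refine Runs.op ?_
      simp only [BinOp.eval, Config.setReg_reg, Operand.val_reg, Operand.val_const, if_true,
        if_false, Nat.reduceEqDiff, Config.setReg_mem, hi, hj, hij, hs.frame.patternLen,
        hashPosOperand, Nat.zero_mod, add_zero, true_and]
      refine ⟨fun r hr => ?_, Nat.mod_eq_of_lt (by omega), Nat.mod_eq_of_lt (by omega)⟩
      simp [show r ≠ 16 by omega, show r ≠ 18 by omega]
    | textOnly =>
      refine Runs.op ?_
      simp only [BinOp.eval, Config.setReg_reg, Operand.val_reg, Operand.val_const, if_true,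
        if_false, Nat.reduceEqDiff, Config.setReg_mem, hi, hj, hij,
        hashPosOperand, Nat.zero_mod, add_zero, true_and]
      refine ⟨fun r hr => ?_, rfl, Nat.mod_eq_of_lt (by omega)⟩
      simp [show r ≠ 16 by omega, show r ≠ 18 by omega]
  rintro s₁ ⟨hr1, hm1, h16, h18⟩
  have hb1 : Base n m k L K w ω X s₁ :=
    hs.congr (fun r _ hr => hr1 r (by omega)) fun _ _ => by rw [hm1]
  refine Runs.load_seq ?_ (Runs.seq (runs_hashAt hl ω (p := p) (a := X A) (v := ω p)
    (hb1.frame.congr fun r _ hr => ?_) ?_ hp ?_ (hX A hadr) ?_) ?_)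
  · rw [Operand.val_reg, h18]; omega
  · simp [show r ≠ 17 by omega]
  · simp [h16]
  · simp [h18, hb1.strings A hadr]
  · rw [Config.setReg_mem, hb1.words p hp]
  rintro s₂ ⟨hr2, hm2, h20, hlt, h21⟩
  simp only [Config.setReg_reg, Config.setReg_mem] at hr2 hm2
  have hr2' : ∀ r < 16, s₂.reg r = s.reg r := fun r hr => by
    rw [hr2 r (by omega), if_neg (by omega), hr1 r hr]
  have e10 : s₂.reg 10 = i := by rw [hr2' 10 (by norm_num), hi]
  have e6 : s₂.reg 6 = L := by rw [hr2' 6 (by norm_num), hs.frame.dim]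
  have e8 : s₂.reg 8 = m + 2 * n := by rw [hr2' 8 (by norm_num), hs.frame.rows]
  have hcL : X A * k + wordBucket k (ω p) < L := by
    rw [hl.dim]; exact coord_lt (hX A hadr) (wordBucket_lt hk _)
  have hcell := hl.cell_word (r := i) (by omega) hcL
  have hclt := cell_lt (m := m) (show i < 4 * n by omega) hcL
  refine Runs.op_seq (Runs.op_seq (Runs.op_seq (Runs.load_seq ?_ (Runs.op_seq (Runs.store ?_ ?_)))))
  · simp only [BinOp.eval, Config.setReg_reg, Operand.val_reg, if_true, if_false,
      Nat.reduceEqDiff, e10, e6, e8, h20, hcell]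
    omega
  · simp only [BinOp.eval, Config.setReg_reg, Operand.val_reg, if_true, if_false,
      Nat.reduceEqDiff, e10, e6, e8, h20, hcell]
    omega
  · simp only [BinOp.eval, Config.setReg_reg, Operand.val_reg, if_true, if_false,
      Nat.reduceEqDiff, e10, e6, e8, h20, hcell, Config.setReg_mem, Config.setMem_reg,
      Config.setMem_mem, hm2, hm1]
    refine ⟨?_, ?_, ?_, ?_⟩
    · intro r hr
      rw [if_neg (by omega), if_neg (by omega), if_neg (by omega), if_neg (by omega),
        if_neg (by omega), hr2' r hr]
    · intro a ha
      rw [Function.update_of_ne]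
      unfold cell
      omega
    · intro i' c' hc' hne
      rw [Function.update_of_ne]
      rw [Ne, cell_inj hc' hcL]
      exact fun h => hne h.1
    · intro c' hc'
      rw [Function.update_apply, cast_contribution]
      simp only [cell_inj hc' hcL, true_and]
      by_cases h : c' = X A * k + wordBucket k (ω p)
      · rw [if_pos h, if_pos h, cast_sub_word hlt.le, h21, h]
      · rw [if_neg h, if_neg h, sub_zero]

theorem runs_addInitial {q n m k L K w S : ℕ} (hl : Layout q n m k L K w S)
    (ω : ℕ → Fin (2 ^ w)) (M : Mode) {X : ℕ → ℕ} (hX : ∀ a < m + n, X a < q) {s : Config}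
    (hs : Base n m k L K w ω X s) {j : ℕ} (hj : s.reg 10 = j) (hjn : j < M.len n m) :
    Runs w S ω (addInitial M) s (12 + addDynTime n M) fun s' => (∀ r < 16, s'.reg r = s.reg r) ∧
      (∀ a < m + 2 * n + n * L, s'.mem a = s.mem a) ∧
      ∀ f, DynRep n m L w M s.mem f → DynRep n m L w M s'.mem fun j' c' =>
        f j' c' + if j' = j then ((contribution k (ω j) (X (dynBase m M + j)) c' : ℤ) :
          ZMod (2 ^ w)) else 0 := by
  have hword := hl.word
  have hspace := hl.space
  have hLn := hl.L_le
  have hk := hl.one_le_k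
  have hjn' : j < n := hjn.trans_le (Mode.len_le hl.m_le_n M)
  have haddr := dynBase_add_lt hjn
  set D := dynBase m M + j with hD
  have hDmod : (j + dynBase m M) % 2 ^ w = D := by
    rw [Nat.mod_eq_of_lt (by omega), add_comm]
  have hjmod : j % 2 ^ w = j := Nat.mod_eq_of_lt (by omega)
  refine Runs.mono (T₁ := 1 + (1 + (1 + (9 + addDynTime n M)))) ?_ (by omega) fun _ h => h
  refine Runs.op_seq (Runs.op_seq (Runs.load_seq ?_ (Runs.seq
    (runs_hashAt hl ω (p := j) (a := X D) (v := ω j) ?_ ?_ hjn' ?_ (hX D haddr) ?_) ?_)))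
  · simp [BinOp.eval, hs.frame.val_dynBaseOperand, hj, hDmod]; omega
  · exact hs.frame.congr fun r _ hr => by
      simp [show r ≠ 16 by omega, show r ≠ 17 by omega, show r ≠ 18 by omega]
  · simp [BinOp.eval, hj, hjmod]
  · simp [BinOp.eval, hs.frame.val_dynBaseOperand, hj, hDmod, hs.strings D haddr]
  · simp only [Config.setReg_mem]
    rw [hs.words j hjn']
  rintro s₁ ⟨hr1, hm1, hc1, hlt1, hd1⟩
  simp only [BinOp.eval, Config.setReg_reg, Operand.val_reg, Operand.val_const, if_true,
    if_false, Nat.reduceEqDiff, Config.setReg_mem, hs.frame.val_dynBaseOperand, hj, hDmod,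
    hs.strings D haddr, Nat.zero_mod, add_zero, hjmod] at hr1 hm1
  have hf1 : Frame n m k L K s₁ := hs.frame.congr fun r _ hr => by
    rw [hr1 r (by omega), if_neg (by omega), if_neg (by omega), if_neg (by omega)]
  have e16 : s₁.reg 16 = j := by rw [hr1 16 (by norm_num)]; simp
  refine (runs_addDyn hl ω M (j := j) (c := X D * k + wordBucket k (ω j)) hf1 e16 hjn hc1
    (by rw [hl.dim]; exact coord_lt (hX D haddr) (wordBucket_lt hk _)) rfl).mono le_rfl ?_
  rintro s₂ ⟨hr2, hm2, hdyn⟩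
  rw [hm1] at hm2 hdyn
  refine ⟨fun r hr => ?_, hm2, fun f hf => ?_⟩
  · rw [hr2 r (by omega), hr1 r (by omega), if_neg (by omega), if_neg (by omega),
      if_neg (by omega)]
  · convert hdyn f hf using 1
    funext j' c'
    rw [hd1, cast_contribution]
    by_cases h : j' = j <;> simp [h]

theorem halts_drawWords {q n m k L K w S : ℕ} (hl : Layout q n m k L K w S)
    (ω : ℕ → Fin (2 ^ w)) {X : ℕ → ℕ} {s : Config} (hf : Frame n m k L K s)
    (hX : ∀ a < m + n, s.mem a = X a) (h0 : ∀ a, m + n ≤ a → s.mem a = 0) (hd : s.drawn = 0)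
    {b : ℕ} (hb : s.reg 14 = b) :
    Halts w S ω (forLoop 10 12 (reg 3) drawWord) s fun s' => Base n m k L K w ω X s' ∧
      s'.reg 14 = b ∧ ∀ a, m + 2 * n ≤ a → s'.mem a = 0 := by
  have hword := hl.word
  have hspace := hl.space
  have hLn := hl.L_le
  let I : ℕ → Config → Prop := fun t s' => (∀ r < 10, s'.reg r = s.reg r) ∧ s'.reg 14 = b ∧
    s'.drawn = t ∧ (∀ a < m + n, s'.mem a = X a) ∧ (∀ p < t, s'.mem (m + n + p) = ω p) ∧
    ∀ a, m + 2 * n ≤ a → s'.mem a = 0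
  refine (Halts.forLoop (N := n) (by norm_num) (by norm_num) (by norm_num) (by omega) I ?_ ?_
    hf.textLen ⟨fun _ _ => rfl, hb, hd, hX, fun p hp => absurd hp (Nat.not_lt_zero p),
      fun a ha => h0 a (by omega)⟩ ?_).mono ?_
  · rintro t s' v ⟨h1, h2, h3, h4, h5, h6⟩
    exact ⟨fun r hr => by simp [show r ≠ 10 by omega, h1 r hr], by simp [h2], h3, h4, h5, h6⟩
  · rintro t s' v ⟨h1, h2, h3, h4, h5, h6⟩
    exact ⟨fun r hr => by simp [show r ≠ 12 by omega, h1 r hr], by simp [h2], h3, h4, h5, h6⟩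
  · rintro t s₁ ht hb1 hi ⟨h1, h2, h3, h4, h5, h6⟩
    have haddr : (m + n + t) % 2 ^ w = m + n + t := Nat.mod_eq_of_lt (by omega)
    have e7 : s₁.reg 7 = m + n := by rw [h1 7 (by norm_num), hf.words]
    refine (Runs.rand_seq (Runs.op_seq (Runs.store ?_ ?_))).halts
    · simp [BinOp.eval, e7, hi, haddr]; omega
    · simp only [BinOp.eval, Config.setReg_reg, Operand.val_reg, if_true, if_false,
        Nat.reduceEqDiff, Config.setReg_mem, Config.setMem_reg, Config.setMem_mem, e7, hi, haddr,
        hb1, I, h2, h3, true_and, Config.setReg_drawn, Config.setMem_drawn]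
      refine ⟨?_, ?_, ?_, ?_⟩
      · intro r hr
        simp [show r ≠ 22 by omega, show r ≠ 23 by omega, h1 r hr]
      · intro a ha
        rw [Function.update_of_ne (by omega), h4 a ha]
      · intro p hp
        by_cases hpt : p = t
        · rw [hpt, Function.update_self]
        · rw [Function.update_of_ne (by omega), h5 p (by omega)]
      · intro a ha
        rw [Function.update_of_ne (by omega), h6 a ha]
  · rintro s' ⟨h1, h2, h3, h4, h5, h6⟩
    exact ⟨⟨hf.congr fun r _ hr => h1 r hr, h4, h5⟩, h2, h6⟩

theorem halts_addFixed_row {q n m k L K w S : ℕ} (hl : Layout q n m k L K w S)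
    (ω : ℕ → Fin (2 ^ w)) (M : Mode) {X : ℕ → ℕ} (hX : ∀ a < m + n, X a < q) {s : Config}
    (hs : Base n m k L K w ω X s) {i b : ℕ} (hi : s.reg 10 = i) (him : i + m ≤ n)
    (hb : s.reg 14 = b) (h0 : ∀ c < L, s.mem (cell n m L i c) = 0) :
    Halts w S ω (forLoop 11 13 (reg 4) (addFixed M)) s fun s' => Base n m k L K w ω X s' ∧
      s'.reg 10 = i ∧ s'.reg 14 = b ∧
      (∀ i' c', c' < L → i' ≠ i → s'.mem (cell n m L i' c') = s.mem (cell n m L i' c')) ∧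
      ∀ c < L, (s'.mem (cell n m L i c) : ZMod (2 ^ w)) = -fixedSketch m k w M ω X i c := by
  have hword := hl.word
  have hLn := hl.L_le
  let I : ℕ → Config → Prop := fun t s' => (Base n m k L K w ω X s' ∧
    s'.reg 10 = i ∧ s'.reg 14 = b) ∧
    (∀ i' c', c' < L → i' ≠ i → s'.mem (cell n m L i' c') = s.mem (cell n m L i' c')) ∧
    ∀ c < L, (s'.mem (cell n m L i c) : ZMod (2 ^ w)) = -∑ j ∈ Finset.range t,
      ((contribution k (ω (hashPos M i j)) (X (fixedAddr m M i j)) c : ℤ) : ZMod (2 ^ w))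
  refine (Halts.forLoop (N := m) (by norm_num) (by norm_num) (by norm_num) (by omega) I ?_ ?_
    hs.frame.patternLen ⟨⟨hs, hi, hb⟩, fun _ _ _ _ => rfl, fun c hc => by simp [h0 c hc]⟩
    ?_).mono ?_
  · rintro t s' v ⟨⟨h1, h2, h3⟩, h4, h5⟩
    exact ⟨⟨h1.congr (fun r _ hr => by simp [show r ≠ 11 by omega]) fun _ _ => rfl,
      by simp [h2], by simp [h3]⟩, h4, h5⟩
  · rintro t s' v ⟨⟨h1, h2, h3⟩, h4, h5⟩
    exact ⟨⟨h1.congr (fun r _ hr => by simp [show r ≠ 13 by omega]) fun _ _ => rfl,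
      by simp [h2], by simp [h3]⟩, h4, h5⟩
  · rintro t s₁ ht hb1 hj ⟨⟨h1, h2, h3⟩, h4, h5⟩
    refine ((runs_addFixed hl ω M hX h1 h2 him hj ht).mono le_rfl ?_).halts
    rintro s₂ ⟨hr, hm, hne, heq⟩
    refine ⟨by rw [hr 4 (by norm_num), hb1], by rw [hr 11 (by norm_num), hj],
      ⟨h1.congr (fun r _ hr' => hr r (by omega)) hm, by rw [hr 10 (by norm_num), h2],
        by rw [hr 14 (by norm_num), h3]⟩, ?_, ?_⟩
    · intro i' c' hc' hii
      rw [hne i' c' hc' hii, h4 i' c' hc' hii]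
    · intro c hc
      rw [heq c hc, h5 c hc, Finset.sum_range_succ]
      ring
  · rintro s' ⟨⟨h1, h2, h3⟩, h4, h5⟩
    exact ⟨h1, h2, h3, h4, h5⟩

theorem halts_addFixed {q n m k L K w S : ℕ} (hl : Layout q n m k L K w S)
    (ω : ℕ → Fin (2 ^ w)) (M : Mode) {X : ℕ → ℕ} (hX : ∀ a < m + n, X a < q) {s : Config}
    (hs : Base n m k L K w ω X s) (hb : s.reg 14 = n - m + 1)
    (h0 : ∀ a, m + 2 * n ≤ a → s.mem a = 0) :
    Halts w S ω (forLoop 10 12 (reg 14) (forLoop 11 13 (reg 4) (addFixed M))) s fun s' =>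
      Base n m k L K w ω X s' ∧
      (∀ i, i + m ≤ n → ∀ c < L,
        (s'.mem (cell n m L i c) : ZMod (2 ^ w)) = -fixedSketch m k w M ω X i c) ∧
      ∀ r, n ≤ r → ∀ c < L, s'.mem (cell n m L r c) = 0 := by
  have hword := hl.word
  have hLn := hl.L_le
  have hm := hl.one_le_m
  have hmn := hl.m_le_n
  let I : ℕ → Config → Prop := fun t s' => Base n m k L K w ω X s' ∧
      (∀ i < t, ∀ c < L,
        (s'.mem (cell n m L i c) : ZMod (2 ^ w)) = -fixedSketch m k w M ω X i c) ∧
      ∀ r, t ≤ r → ∀ c < L, s'.mem (cell n m L r c) = 0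
  refine (Halts.forLoop (N := n - m + 1) (by norm_num) (by norm_num) (by norm_num) (by omega) I
    ?_ ?_ hb ⟨hs, fun i hi => absurd hi (Nat.not_lt_zero i),
      fun r _ c _ => h0 _ (by unfold cell; omega)⟩ ?_).mono ?_
  · rintro t s' v ⟨h1, h2, h3⟩
    exact ⟨h1.congr (fun r _ hr => by simp [show r ≠ 10 by omega]) fun _ _ => rfl, h2, h3⟩
  · rintro t s' v ⟨h1, h2, h3⟩
    exact ⟨h1.congr (fun r _ hr => by simp [show r ≠ 12 by omega]) fun _ _ => rfl, h2, h3⟩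
  · rintro t s₁ ht hb1 hi ⟨h1, h2, h3⟩
    refine (halts_addFixed_row hl ω M hX h1 hi (by omega) hb1 fun c hc => h3 t le_rfl c hc).mono ?_
    rintro s₂ ⟨g1, g2, g3, g4, g5⟩
    refine ⟨g3, g2, g1, ?_, ?_⟩
    · intro i hit c hc
      by_cases h : i = t
      · rw [h]; exact g5 c hc
      · rw [g4 i c hc h, h2 i (by omega) c hc]
    · intro r hr c hc
      rw [g4 r c hc (by omega), h3 r (by omega) c hc]
  · rintro s' ⟨h1, h2, h3⟩
    exact ⟨h1, fun i him => h2 i (by omega), fun r hr => h3 r (by omega)⟩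

theorem halts_addInitial {q n m k L K w S : ℕ} (hl : Layout q n m k L K w S)
    (ω : ℕ → Fin (2 ^ w)) (M : Mode) {X : ℕ → ℕ} (hX : ∀ a < m + n, X a < q) {s : Config}
    (hs : Base n m k L K w ω X s)
    (hfix : ∀ i, i + m ≤ n → ∀ c < L,
      (s.mem (cell n m L i c) : ZMod (2 ^ w)) = -fixedSketch m k w M ω X i c)
    (h0 : ∀ r, n ≤ r → ∀ c < L, s.mem (cell n m L r c) = 0) :
    Halts w S ω (forLoop 10 12 (reg (lenReg M)) (addInitial M)) s
      (Inv n m k L K w M ω X) := by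
  have hword := hl.word
  have hLn := hl.L_le
  have hm := hl.one_le_m
  have hlen := Mode.len_le hl.m_le_n M
  let I : ℕ → Config → Prop := fun t s' => Base n m k L K w ω X s' ∧
    (∀ a < m + 2 * n + n * L, s'.mem a = s.mem a) ∧
    DynRep n m L w M s'.mem fun j c => if j < t then
      ((contribution k (ω j) (X (dynBase m M + j)) c : ℤ) : ZMod (2 ^ w)) else 0
  have hne : lenReg M < 10 := by cases M <;> simp [lenReg]
  refine (Halts.forLoop (N := M.len n m) (by norm_num) (by omega) (by omega) (by omega) I
    ?_ ?_ (hs.frame.reg_lenReg M) ⟨hs, fun _ _ => rfl, ?_⟩ ?_).mono ?_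
  · rintro t s' v ⟨h1, h2, h3⟩
    exact ⟨h1.congr (fun r _ hr => by simp [show r ≠ 10 by omega]) fun _ _ => rfl, h2, h3⟩
  · rintro t s' v ⟨h1, h2, h3⟩
    exact ⟨h1.congr (fun r _ hr => by simp [show r ≠ 12 by omega]) fun _ _ => rfl, h2, h3⟩
  · cases M with
    | patternOnly => intro c hc; simp [h0 n le_rfl c hc]
    | textOnly =>
      refine ⟨fun j _ c hc => ?_, fun v _ _ c hc => ?_⟩
      · simp [h0 (n + (n + j)) (by omega) c hc]
      · rw [h0 _ (by omega) c hc, h0 _ (by omega) c hc, h0 _ (by omega) c hc]; simp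
  · rintro t s₁ ht hb1 hi ⟨h1, h2, h3⟩
    refine ((runs_addInitial hl ω M hX h1 hi ht).mono le_rfl ?_).halts
    rintro s₂ ⟨hr, hm2, hdyn⟩
    refine ⟨by rw [hr _ (by omega), hb1], by rw [hr 10 (by norm_num), hi],
      h1.congr (fun r _ hr' => hr r (by omega)) fun a ha => hm2 a (by omega), ?_, ?_⟩
    · intro a ha
      rw [hm2 a ha, h2 a ha]
    · convert hdyn _ h3 using 1
      funext j c
      by_cases h : j = t
      · simp [h]
      · simp [h, show j < t + 1 ↔ j < t by omega]
  · rintro s' ⟨h1, h2, h3⟩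
    refine ⟨h1.frame, h1.strings, h1.words, fun i him c hc => ?_, h3⟩
    rw [h2 _ (cell_lt_cell (by omega) hc), hfix i him c hc]

theorem startConfig_mem_lt {q n m K : ℕ} (x : Strings q n m) {a : ℕ} (ha : a < m + n) :
    (startConfig x K).mem a < q := by
  simp only [startConfig]
  split_ifs
  · exact Fin.is_lt _
  · exact Fin.is_lt _
  · omega

theorem halts_preprocess {q C₀ n m k L K w S : ℕ} (hl : Layout q n m k L K w S)
    (hC : 1 ≤ C₀) (hk : k = K * K * C₀) (ω : ℕ → Fin (2 ^ w)) (M : Mode) (x : Strings q n m) :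
    Halts w S ω (preprocess q C₀ M) (startConfig x K)
      (Inv n m k L K w M ω (startConfig x K).mem) := by
  have hword := hl.word
  have hspace := hl.space
  have hLn := hl.L_le
  have hkL := hl.k_le_L
  have hm := hl.one_le_m
  have hmn := hl.m_le_n
  have hk1 := hl.one_le_k
  have hX : ∀ a < m + n, (startConfig x K).mem a < q := fun a ha => startConfig_mem_lt x ha
  have hqL : q ≤ L := by rw [hl.dim]; exact Nat.le_mul_of_pos_right _ hk1
  have hKK : K * K ≤ k := by rw [hk]; exact Nat.le_mul_of_pos_right _ hC
  have hCk : C₀ ≤ k := by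
    rw [hk]; exact Nat.le_mul_of_pos_left _ (Nat.mul_pos hl.one_le_K hl.one_le_K)
  have hnL : n * L ≤ 4 * n * L := Nat.mul_le_mul_right _ (by omega)
  have e1 : n % 2 ^ w = n := Nat.mod_eq_of_lt (by omega)
  have e2 : m % 2 ^ w = m := Nat.mod_eq_of_lt (by omega)
  have e3 : K * K % 2 ^ w = K * K := Nat.mod_eq_of_lt (by omega)
  have e4 : C₀ % 2 ^ w = C₀ := Nat.mod_eq_of_lt (by omega)
  have e5 : k % 2 ^ w = k := Nat.mod_eq_of_lt (by omega)
  have e6 : q % 2 ^ w = q := Nat.mod_eq_of_lt (by omega)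
  have e7 : L % 2 ^ w = L := Nat.mod_eq_of_lt (by omega)
  have e8 : (m + n) % 2 ^ w = m + n := Nat.mod_eq_of_lt (by omega)
  have e9 : (m + n + n) % 2 ^ w = m + 2 * n := by rw [Nat.mod_eq_of_lt] <;> omega
  have e10 : n * L % 2 ^ w = n * L := Nat.mod_eq_of_lt (by omega)
  have e11 : (m + 2 * n + n * L) % 2 ^ w = m + 2 * n + n * L := Nat.mod_eq_of_lt (by omega)
  have e12 : (n + (2 ^ w - m)) % 2 ^ w = n - m := by
    rw [show n + (2 ^ w - m) = (n - m) + 2 ^ w by omega, Nat.add_mod_right]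
    exact Nat.mod_eq_of_lt (by omega)
  have e13 : 1 % 2 ^ w = 1 := Nat.mod_eq_of_lt (by omega)
  have e14 : (n - m + 1) % 2 ^ w = n - m + 1 := Nat.mod_eq_of_lt (by omega)
  have r0 : (startConfig x K).reg 0 = n := rfl
  have r1 : (startConfig x K).reg 1 = m := rfl
  have r2 : (startConfig x K).reg 2 = K := rfl
  iterate 11
    refine Halts.op_seq ?_
  refine Halts.seq (halts_drawWords hl ω (X := (startConfig x K).mem) (b := n - m + 1)
    ?_ ?_ ?_ rfl ?_) ?_
  · constructor <;>
    simp only [BinOp.eval, Config.setReg_reg, Operand.val_reg, Operand.val_const, if_true,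
      if_false, Nat.reduceEqDiff, OfNat.one_ne_ofNat, Nat.zero_mod, add_zero,
      r0, r1, r2, e1, e2, e3, e4, ← hk, e5, e6, ← hl.dim, e7, e8, e9, e10, e11]
  · intro a _
    rfl
  · intro a ha
    simp only [Config.setReg_mem, startConfig]
    rw [dif_neg (by omega), dif_neg (by omega)]
  · simp only [BinOp.eval, Config.setReg_reg, Operand.val_reg, Operand.val_const, if_true,
      if_false, Nat.reduceEqDiff, OfNat.one_ne_ofNat, Nat.zero_mod, add_zero,
      r0, r1, e1, e2, e12, e13, e14]
  rintro s₁ ⟨h1, h2, h3⟩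
  refine Halts.seq (halts_addFixed hl ω M hX h1 h2 h3) ?_
  rintro s₂ ⟨g1, g2, g3⟩
  exact halts_addInitial hl ω M hX g1 g2 g3

/-! ### Correctness and resource bounds -/

/-- The data structure for alphabet size `q` with `C₀ * K ^ 2` buckets. -/
def sketchStructure (q C₀ : ℕ) (M : Mode) : DataStructure where
  preprocess := preprocess q C₀ M
  update := update M
  query := query M

theorem val_update_apply {l q : ℕ} (f : Fin l → Fin q) (j : Fin l) (a : Fin q) {b : ℕ}
    (h : b < l) : (Function.update f j a ⟨b, h⟩ : ℕ) = if b = j then (a : ℕ) else f ⟨b, h⟩ := by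
  rw [Function.update_apply, apply_ite Fin.val]
  simp only [Fin.ext_iff]

theorem startConfig_mem_update {q n m K : ℕ} (x : Strings q n m) (M : Mode)
    (j : Fin (M.len n m)) (a : Fin q) : (startConfig (x.update M j a) K).mem =
      Function.update (startConfig x K).mem (dynBase m M + j) a := by
  funext b
  cases M with
  | patternOnly =>
    have hj : (j : ℕ) < m := j.2
    simp only [startConfig, Strings.update, dynBase, zero_add, Function.update_apply]
    by_cases h : b < m
    · simp only [dif_pos h]
      exact val_update_apply x.pattern j a h
    · rw [dif_neg h, dif_neg h, if_neg (by omega)]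
  | textOnly =>
    have hj : (j : ℕ) < n := j.2
    simp only [startConfig, Strings.update, dynBase, Function.update_apply]
    by_cases h : b < m
    · rw [dif_pos h, dif_pos h, if_neg (by omega)]
    · rw [dif_neg h, dif_neg h]
      by_cases h' : b - m < n
      · simp only [dif_pos h', show b = m + (j : ℕ) ↔ b - m = j by omega]
        exact val_update_apply x.text j a h'
      · rw [dif_neg h', dif_neg h', if_neg (by omega)]

theorem after_append {M : Mode} {q n m : ℕ} (x : Strings q n m) (ops : List (Op M q n m))
    (o : Op M q n m) : x.after (ops ++ [o]) = o.apply (x.after ops) := by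
  simp [Strings.after, List.foldl_append]

/-- The number of steps allowed for an operation. -/
def opTime {M : Mode} {q n m : ℕ} (L : ℕ) : Op M q n m → ℕ
  | .update _ _ => 24 + 2 * addDynTime n M
  | .query _ _ => 2 + (L * (readDynTime n M + 8 + 1) + 1) + 5

theorem runs_op {q C₀ n m k L K w S : ℕ} (hl : Layout q n m k L K w S) (ω : ℕ → Fin (2 ^ w))
    {M : Mode} (x : Strings q n m) {s : Config}
    (hs : Inv n m k L K w M ω (startConfig x K).mem s) (o : Op M q n m) :
    Runs w S ω (o.prog (sketchStructure q C₀ M)) (o.call s) (opTime L o)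
      (Inv n m k L K w M ω (startConfig (o.apply x) K).mem) := by
  cases o with
  | update j a =>
    simp only [Op.apply, startConfig_mem_update]
    refine runs_update hl ω M (s := Op.call s (.update j a)) (fun a ha => startConfig_mem_lt x ha)
      (hs.congr (fun r hr _ => ?_) rfl) ?_ j.2 ?_ a.2
    · simp [Op.call, show r ≠ 0 by omega, show r ≠ 1 by omega]
    · simp [Op.call]
    · simp [Op.call]
  | query i hi =>
    refine (runs_query hl ω M (s := Op.call s (.query (M := M) (q := q) i hi))
      (hs.congr (fun r hr _ => ?_) rfl) (i := i) ?_ hi).mono le_rfl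
      fun _ h => h.1
    · simp [Op.call, show r ≠ 0 by omega]
    · simp [Op.call]

theorem inv_of_reach {q C₀ n m k L K w S : ℕ} (hl : Layout q n m k L K w S) (hC : 1 ≤ C₀)
    (hk : k = K * K * C₀) {ω : ℕ → Fin (2 ^ w)} {M : Mode} {x : Strings q n m}
    {ops : List (Op M q n m)} {s : Config}
    (h : Reach w S ω (sketchStructure q C₀ M) K x ops s) :
    Inv n m k L K w M ω (startConfig (x.after ops) K).mem s := by
  induction h with
  | start h =>
    obtain ⟨t, s', h', hs'⟩ := halts_preprocess hl hC hk ω M x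
    obtain ⟨-, rfl⟩ := h'.det h
    exact hs'
  | step o _ h ih =>
    obtain ⟨t, s', h', -, hs'⟩ := runs_op (C₀ := C₀) hl ω _ ih o
    obtain ⟨-, rfl⟩ := h'.det h
    rw [after_append]
    exact hs'

theorem exists_reach {q C₀ n m k L K w S : ℕ} (hl : Layout q n m k L K w S) (hC : 1 ≤ C₀)
    (hk : k = K * K * C₀) (ω : ℕ → Fin (2 ^ w)) {M : Mode} (x : Strings q n m)
    (ops : List (Op M q n m)) : ∃ s, Reach w S ω (sketchStructure q C₀ M) K x ops s := by
  induction ops using List.reverseRecOn with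
  | nil =>
    obtain ⟨t, s', h', -⟩ := halts_preprocess hl hC hk ω M x
    exact ⟨s', .start h'⟩
  | append_singleton ops o ih =>
    obtain ⟨s, hs⟩ := ih
    obtain ⟨t, s', h', -, -⟩ := runs_op (C₀ := C₀) hl ω _ (inv_of_reach hl hC hk hs) o
    exact ⟨s', .step o hs h'⟩

/-- The word estimate is the reduction of the integer estimate modulo the word size. -/
theorem wordEstimate_eq {q n m k L K w S : ℕ} (hl : Layout q n m k L K w S)
    (ω : ℕ → Fin (2 ^ w)) (M : Mode) (x : Strings q n m) {i : ℕ} (hi : i + m ≤ n) :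
    wordEstimate n m k L w M ω (startConfig x K).mem i =
      (sketchDist q k m (fun j => ω (hashPos M i j)) (fun j => x.pattern j)
        (fun j => x.text ⟨i + j, by omega⟩) : ℤ) := by
  have hmn := hl.m_le_n
  unfold wordEstimate sketchDist
  rw [hl.dim]
  push_cast
  refine Finset.sum_congr rfl fun c _ => ?_
  have hP : ∀ j : Fin m, (startConfig x K).mem j = x.pattern j := fun j => by
    simp [startConfig]
  have hT : ∀ j : Fin m, (startConfig x K).mem (m + (i + j)) = x.text ⟨i + j, by omega⟩ :=
    fun j => by
      have : i + (j : ℕ) < n := by omega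
      simp [startConfig, this]
  unfold fixedSketch
  cases M with
  | patternOnly =>
    rw [Finset.sum_range, Finset.sum_range, ← Finset.sum_sub_distrib]
    congr 1
    refine Finset.sum_congr rfl fun j _ => ?_
    have hj : (j : ℕ) < Mode.len n m .patternOnly := j.2
    simp only [dynContribution, hashPos, hj, if_true, dynBase, zero_add, fixedAddr, hP, hT]
  | textOnly =>
    rw [Finset.sum_range, Finset.sum_range, ← Finset.sum_sub_distrib, ← neg_sq,
      ← Finset.sum_neg_distrib]
    congr 1
    refine Finset.sum_congr rfl fun j _ => ?_
    have hj : i + (j : ℕ) < Mode.len n m .textOnly := by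
      have := j.2
      change i + (j : ℕ) < n
      omega
    simp only [dynContribution, hashPos, hj, if_true, dynBase, fixedAddr, hP, hT]
    ring

/-- Rounding: an estimate of `2 d` with relative error `1 / (3 K)`, multiplied by
`3 K / (2 (3 K - 1))` and rounded down, lies between `d` and `(1 + 1 / K) d`. -/
theorem isApprox_of_estimate {K d w : ℕ} {ε : ℝ} (hε : 0 < ε) (hK : 1 ≤ K) (hKε : 1 / ε ≤ K)
    (hw : 8 * (K * d) < 2 ^ w) {Z : ℤ} (hZ : 3 * (K : ℤ) * |Z - 2 * d| ≤ 2 * d) :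
    IsApprox ε d ((Z : ZMod (2 ^ w)).val * (3 * K) % 2 ^ w / (2 * (3 * K - 1))) := by
  have hK' : (1 : ℤ) ≤ K := by exact_mod_cast hK
  have hd0 : (0 : ℤ) ≤ d := by positivity
  have habs : |3 * (K : ℤ) * (Z - 2 * d)| ≤ 2 * d := by
    rw [abs_mul, abs_of_nonneg (by omega : (0 : ℤ) ≤ 3 * K)]; exact hZ
  obtain ⟨h1, h2⟩ := abs_le.mp habs
  have hKd : (d : ℤ) ≤ K * d := le_mul_of_one_le_left hd0 hK'
  have hZ0 : 0 ≤ Z := by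
    by_contra hneg
    have : Z + 1 ≤ 0 := by omega
    nlinarith
  lift Z to ℕ using hZ0 with z
  have hz3 : (z * (3 * K) : ℤ) ≤ 6 * (K * d) + 2 * d := by linarith
  have hz3' : z * (3 * K) ≤ 6 * (K * d) + 2 * d := by exact_mod_cast hz3
  have hz4 : 6 * (K * d) ≤ z * (3 * K) + 2 * d := by
    have : (6 * (K * d) : ℤ) ≤ z * (3 * K) + 2 * d := by linarith
    exact_mod_cast this
  have hKdn : d ≤ K * d := Nat.le_mul_of_pos_left _ hK
  have hzle : z ≤ z * (3 * K) := Nat.le_mul_of_pos_right _ (by omega)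
  have hval : ((z : ℤ) : ZMod (2 ^ w)).val = z := by
    rw [Int.cast_natCast, ZMod.val_cast_of_lt (by omega)]
  rw [hval, Nat.mod_eq_of_lt (by omega)]
  -- Shifting `K` makes the truncated subtraction in the denominator harmless.
  obtain ⟨K, rfl⟩ : ∃ K', K = K' + 1 := ⟨K - 1, by omega⟩
  set A := z * (3 * (K + 1)) / (2 * (3 * (K + 1) - 1)) with hA
  have hpos : 0 < 2 * (3 * (K + 1) - 1) := by omega
  have hD : 2 * (3 * (K + 1) - 1) = 6 * K + 4 := by omega
  rw [hD] at hpos hA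
  constructor
  · have : d ≤ A := by
      rw [hA, Nat.le_div_iff_mul_le hpos]
      nlinarith
    exact_mod_cast this
  · have h3 : A * (6 * K + 4) ≤ z * (3 * (K + 1)) := by
      rw [hA]; exact Nat.div_mul_le_self _ _
    have h5 : A * (K + 1) ≤ (K + 2) * d := by
      have h6 : A * (6 * K + 4) * (K + 1) ≤ (6 * ((K + 1) * d) + 2 * d) * (K + 1) :=
        Nat.mul_le_mul_right _ (h3.trans hz3')
      have h7 : (6 * ((K + 1) * d) + 2 * d) * (K + 1) ≤ (6 * K + 4) * ((K + 2) * d) := by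
        nlinarith [Nat.zero_le (K * d)]
      refine Nat.le_of_mul_le_mul_left ?_ hpos
      calc _ = A * (6 * K + 4) * (K + 1) := by ring
        _ ≤ _ := h6.trans h7
    have h5' : (A : ℝ) * (K + 1) ≤ (K + 2) * d := by exact_mod_cast h5
    have hKε' : 1 ≤ ε * (K + 1) := by
      rw [div_le_iff₀ hε] at hKε
      push_cast at hKε
      linarith
    have hd : (0 : ℝ) ≤ d := by positivity
    have hK0 : (0 : ℝ) < K + 1 := by positivity
    refine le_of_mul_le_mul_right ?_ hK0
    nlinarith

theorem hashPos_strictMono (M : Mode) (i m : ℕ) :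
    StrictMono fun j : Fin m => hashPos M i j := by
  intro a b h
  cases M <;> simpa [hashPos] using h

/-- The data structure is correct whenever the parameters fit and the time bounds are met. -/
theorem solves_sketchStructure {q C₀ n m k L w : ℕ} {ε δ tu tq sp : ℝ} {M : Mode} (hε : 0 < ε)
    (hl : Layout q n m k L ⌈1 / ε⌉₊ w ⌊sp⌋₊) (hC : 1 ≤ C₀) (hk : k = ⌈1 / ε⌉₊ * ⌈1 / ε⌉₊ * C₀)
    (hδ : 72 / (C₀ : ℝ) ≤ δ) (htu : ((24 + 2 * addDynTime n M : ℕ) : ℝ) ≤ tu)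
    (htq : ((2 + (L * (readDynTime n M + 8 + 1) + 1) + 5 : ℕ) : ℝ) ≤ tq) :
    Solves (sketchStructure q C₀ M) M q n m w ε δ tu tq sp where
  preprocess_halts x ω := by
    obtain ⟨t, s, h, -⟩ := halts_preprocess hl hC hk ω M x
    exact ⟨t, s, h⟩
  time_le x ω ops s o h := by
    obtain ⟨t, s', h', ht, -⟩ := runs_op (C₀ := C₀) hl ω _ (inv_of_reach hl hC hk h) o
    refine ⟨t, s', h', (Nat.cast_le.mpr ht).trans ?_⟩
    cases o with
    | update j a => exact htu
    | query i hi => exact htq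
  error_le x ops i hi := by
    set K := ⌈1 / ε⌉₊ with hKdef
    have hk1 := hl.one_le_k
    have hword := hl.word
    have hLn := hl.L_le
    have hkL := hl.k_le_L
    have hbuck := hl.buckets
    have hm := hl.one_le_m
    have hmn := hl.m_le_n
    have hw : 1 ≤ w := by
      rcases Nat.eq_zero_or_pos w with h | h
      · rw [h, pow_zero] at hword; omega
      · exact h
    have hK0 : (0 : ℝ) < K := by exact_mod_cast hl.one_le_K
    have hC0 : (0 : ℝ) < C₀ := by exact_mod_cast hC
    set y := x.after ops with hy
    let P : Fin m → ℕ := fun j => y.pattern j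
    let T : Fin m → ℕ := fun j => y.text ⟨i + j, by omega⟩
    have hdist : hammingDist P T = y.dist i hi := by
      unfold Strings.dist
      exact hammingDist_comp (fun _ => Fin.val) (fun _ => Fin.val_injective)
    have hdm : y.dist i hi ≤ m := by
      unfold Strings.dist
      exact hammingDist_le_card_fintype.trans (by simp)
    refine le_trans (measure_mono ?_) ((randomWords_sketchDist_le (q := q) (k := k) hw hk1
      (by omega) hl.one_le_K (hashPos_strictMono M i m) P T (fun j => Fin.is_lt _)
      (fun j => Fin.is_lt _)).trans ?_)
    -- If the integer estimate is good, the program answers correctly.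
    · intro ω hω hgood
      refine hω ?_
      obtain ⟨s, hs⟩ := exists_reach hl hC hk ω x ops
      have hinv := inv_of_reach hl hC hk hs
      obtain ⟨t, s', h', -, -, hans⟩ := runs_query hl ω M (s := Op.call s (.query (M := M) (q := q) i hi))
        (hinv.congr (fun r hr _ => by simp [Op.call, show r ≠ 0 by omega]) rfl)
        (i := i) (by simp [Op.call]) hi
      refine ⟨s', .step _ hs h', ?_⟩
      rw [hans, wordEstimate_eq hl ω M y hi, ← hdist]
      refine isApprox_of_estimate hε hl.one_le_K (Nat.le_ceil _) ?_ hgood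
      have h1 : K * hammingDist P T ≤ K * n := Nat.mul_le_mul_left _ (by omega)
      have h2 : 4 * n * (16 * K) ≤ 4 * n * L := Nat.mul_le_mul_left _ (by omega)
      have h3 : 4 * n * (16 * K) = 64 * (K * n) := by ring
      omega
    · refine ENNReal.ofReal_le_ofReal (le_trans (le_of_eq ?_) hδ)
      rw [hk]
      push_cast
      field_simp

/-- The memory has at most `7 q C₀ (n K) ^ 2` words, so a word of `c₀ + 2` times the bit length of
`n K` can address it if `c₀` accounts for the constant factor. -/
theorem layout_of_word {q C₀ n m K w S c₀ : ℕ} (hq : 1 ≤ q) (hC : 16 ≤ C₀) (hm : 1 ≤ m)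
    (hmn : m ≤ n) (hK : 1 ≤ K) (hc₀ : 7 * q * C₀ ≤ 2 ^ c₀)
    (hw : (c₀ + 2) * (Nat.log 2 (n * K) + 1) ≤ w)
    (hS : m + 2 * n + 4 * n * (q * (K * K * C₀)) ≤ S) :
    Layout q n m (K * K * C₀) (q * (K * K * C₀)) K w S where
  one_le_m := hm
  m_le_n := hmn
  one_le_K := hK
  one_le_q := hq
  buckets := by
    calc 16 * K ≤ C₀ * (K * K) := Nat.mul_le_mul hC (Nat.le_mul_of_pos_left _ hK)
      _ = K * K * C₀ := by ring
  dim := rfl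
  space := hS
  word := by
    have hN : n * K < 2 ^ (Nat.log 2 (n * K) + 1) := Nat.lt_pow_succ_log_self (by norm_num) _
    set b := Nat.log 2 (n * K) + 1
    have hn : 1 ≤ n := hm.trans hmn
    have h1 : (c₀ + 2) * b = c₀ * b + 2 * b := by ring
    have h2 : c₀ ≤ c₀ * b := Nat.le_mul_of_pos_right _ (Nat.succ_pos _)
    have h3 : n * (q * (K * K * C₀)) ≤ q * C₀ * (n * K) ^ 2 := by
      have : n ≤ n ^ 2 := Nat.le_self_pow (by norm_num) n
      calc n * (q * (K * K * C₀)) = n * (q * C₀ * K ^ 2) := by ring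
        _ ≤ n ^ 2 * (q * C₀ * K ^ 2) := Nat.mul_le_mul_right _ this
        _ = _ := by ring
    have h4 : n ≤ n * (q * (K * K * C₀)) := Nat.le_mul_of_pos_right _ (by positivity)
    calc m + 2 * n + 4 * n * (q * (K * K * C₀)) ≤ 7 * (n * (q * (K * K * C₀))) := by
          rw [mul_assoc 4]; omega
      _ ≤ 7 * q * C₀ * (n * K) ^ 2 := by rw [mul_assoc 7, mul_assoc 7]; omega
      _ < 7 * q * C₀ * (2 ^ b) ^ 2 := by
          refine Nat.mul_lt_mul_of_pos_left (Nat.pow_lt_pow_left hN (by norm_num)) (by positivity)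
      _ ≤ 2 ^ c₀ * (2 ^ b) ^ 2 := Nat.mul_le_mul_right _ hc₀
      _ = 2 ^ (c₀ + 2 * b) := by rw [← pow_mul, ← pow_add, mul_comm b]
      _ ≤ 2 ^ w := Nat.pow_le_pow_right (by norm_num) (by omega)

/-- With an empty alphabet there are no strings. -/
theorem solves_zero {D : DataStructure} {M : Mode} {n m w : ℕ} {ε δ tu tq sp : ℝ} (hm : 1 ≤ m) :
    Solves D M 0 n m w ε δ tu tq sp where
  preprocess_halts x := (x.pattern ⟨0, hm⟩).elim0
  time_le x := (x.pattern ⟨0, hm⟩).elim0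
  error_le x := (x.pattern ⟨0, hm⟩).elim0

theorem natLog_le {n : ℕ} (hn : 1 ≤ n) : (Nat.log 2 n : ℝ) ≤ 2 * Real.log n := by
  have h1 : (2 : ℝ) ^ Nat.log 2 n ≤ n := by exact_mod_cast Nat.pow_log_le_self 2 (by omega)
  have h2 := Real.log_le_log (by positivity) h1
  rw [Real.log_pow] at h2
  have h3 := Real.log_two_gt_d9
  have h4 : (0 : ℝ) ≤ Nat.log 2 n := by positivity
  nlinarith

theorem accuracy_bounds {ε : ℝ} (hε : 0 < ε) (hε1 : ε ≤ 1) :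
    1 ≤ ⌈1 / ε⌉₊ ∧ (⌈1 / ε⌉₊ : ℝ) * ⌈1 / ε⌉₊ ≤ 4 * (1 / ε ^ 2) := by
  have h1 : 1 ≤ 1 / ε := by rw [le_div_iff₀ hε]; linarith
  refine ⟨Nat.one_le_ceil_iff.mpr (by linarith), ?_⟩
  have h2 : (⌈1 / ε⌉₊ : ℝ) ≤ 2 * (1 / ε) := by
    have := Nat.ceil_lt_add_one (show 0 ≤ 1 / ε by linarith)
    linarith
  calc (⌈1 / ε⌉₊ : ℝ) * ⌈1 / ε⌉₊ ≤ (2 * (1 / ε)) * (2 * (1 / ε)) := by gcongr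
    _ = _ := by field_simp; norm_num

/-- The bounds for both modes in terms of a factor `ℓ` that dominates the cost of one access to the
sketch of the updatable string. -/
theorem solves_of_factor {q : ℕ} {δ : ℝ} (hδ : 0 < δ) (hδ1 : δ < 1) (M : Mode) :
    ∃ (D : DataStructure) (c : ℕ) (C : ℝ), ∀ (n m w : ℕ) (ε ℓ : ℝ), 1 ≤ m → m ≤ n → 0 < ε →
      ε ≤ 1 → c * (Nat.log 2 (n * ⌈1 / ε⌉₊) + 1) ≤ w → 1 ≤ ℓ →
      (addDynTime n M : ℝ) ≤ 18 * ℓ → (readDynTime n M : ℝ) ≤ 45 * ℓ →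
      Solves D M q n m w ε δ (C * (1 / ε * ℓ)) (C * (1 / ε ^ 2 * ℓ)) (C * (1 / ε ^ 2 * (n * ℓ))) := by
  rcases Nat.eq_zero_or_pos q with rfl | hq
  · exact ⟨⟨skip, skip, skip⟩, 0, 0, fun n m w ε ℓ hm _ _ _ _ _ _ _ => solves_zero hm⟩
  -- The constant `72` of `randomWords_sketchDist_le`.
  set C₀ := ⌈72 / δ⌉₊ with hC₀
  have h72 : 72 / δ ≤ C₀ := Nat.le_ceil _
  have hC72 : (72 : ℝ) ≤ C₀ := by
    refine le_trans ?_ h72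
    rw [le_div_iff₀ hδ]
    linarith
  have hC16 : 16 ≤ C₀ := by
    have : 72 ≤ C₀ := by exact_mod_cast hC72
    omega
  have hq1 : (1 : ℝ) ≤ q := by exact_mod_cast hq
  have hqC : (1 : ℝ) ≤ q * C₀ := by nlinarith
  refine ⟨sketchStructure q C₀ M, 7 * q * C₀ + 2, 300 * (q * C₀), ?_⟩
  intro n m w ε ℓ hm hmn hε hε1 hw hℓ hadd hread
  obtain ⟨hK1, hKK⟩ := accuracy_bounds hε hε1
  set K := ⌈1 / ε⌉₊ with hK
  have hn1 : (1 : ℝ) ≤ n := by exact_mod_cast hm.trans hmn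
  have hmn' : (m : ℝ) ≤ n := by exact_mod_cast hmn
  have hε0 : 1 ≤ 1 / ε := by rw [le_div_iff₀ hε]; linarith
  have hε2 : 1 ≤ 1 / ε ^ 2 := by
    rw [← one_div_pow]; exact one_le_pow₀ hε0
  set E := 1 / ε ^ 2 with hE
  have hL : (q : ℝ) * (K * K * C₀) ≤ 4 * (E * (q * C₀)) := by
    calc (q : ℝ) * (K * K * C₀) = (K * K) * (q * C₀) := by ring
      _ ≤ (4 * E) * (q * C₀) := by gcongr
      _ = _ := by ring
  have hEq : 1 ≤ E * (q * C₀) := one_le_mul_of_one_le_of_one_le hε2 hqC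
  -- Up to a factor `4`, the number `G` is the length of a sketch; it governs time and space.
  set G := E * (q * C₀) with hG
  have hGℓ : G ≤ G * ℓ := le_mul_of_one_le_right (by linarith) hℓ
  refine solves_sketchStructure hε (layout_of_word hq hC16 hm hmn hK1
    (Nat.lt_two_pow_self).le hw ?_) (by omega) rfl ?_ ?_ ?_
  · refine Nat.le_floor ?_
    push_cast
    calc (m : ℝ) + 2 * n + 4 * n * (q * (K * K * C₀)) ≤ n + 2 * n + 4 * n * (4 * G) := by gcongr
      _ ≤ 300 * (n * G) := by nlinarith
      _ ≤ 300 * (n * (G * ℓ)) := by gcongr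
      _ = _ := by rw [hG]; ring
  · rw [div_le_iff₀ (by linarith), mul_comm]
    rwa [div_le_iff₀ hδ] at h72
  · push_cast
    calc (24 : ℝ) + 2 * addDynTime n M ≤ 300 * ((q * C₀) * ℓ) := by nlinarith
      _ ≤ 300 * ((q * C₀) * (1 / ε * ℓ)) := by
        gcongr
        exact le_mul_of_one_le_left (by linarith) hε0
      _ = _ := by ring
  · push_cast
    calc 2 + ((q : ℝ) * (K * K * C₀) * (readDynTime n M + 8 + 1) + 1) + 5
        ≤ 2 + (4 * G * (45 * ℓ + 8 + 1) + 1) + 5 := by gcongr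
      _ ≤ 300 * (G * ℓ) := by nlinarith
      _ = _ := by rw [hG]; ring

end DynApproxHD

/-- The data structure may depend on the alphabet size `q` and the failure probability `δ` only;
so may the word-size constant `c` and the constant `C`. The exponent `e` is absolute. -/
theorem mainTheorem7 :
    -- updates to the pattern only
    (∀ (q : ℕ) (δ : ℝ), 0 < δ → δ < 1 →
      ∃ (D : DynApproxHD.DataStructure) (c : ℕ) (C : ℝ),
        ∀ (n m w : ℕ) (ε : ℝ), 1 ≤ m → m ≤ n → 0 < ε → ε ≤ 1 →
          c * (Nat.log 2 (n * ⌈1 / ε⌉₊) + 1) ≤ w →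
          DynApproxHD.Solves D .patternOnly q n m w ε δ
            (C * (1 / ε)) (C * (1 / ε ^ 2)) (C * (1 / ε ^ 2 * n))) ∧
    -- updates to the text only
    (∃ e : ℕ, ∀ (q : ℕ) (δ : ℝ), 0 < δ → δ < 1 →
      ∃ (D : DynApproxHD.DataStructure) (c : ℕ) (C : ℝ),
        ∀ (n m w : ℕ) (ε : ℝ), 1 ≤ m → m ≤ n → 0 < ε → ε ≤ 1 →
          c * (Nat.log 2 (n * ⌈1 / ε⌉₊) + 1) ≤ w →
          DynApproxHD.Solves D .textOnly q n m w ε δ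
            (C * (1 / ε * (1 + Real.log n) ^ e)) (C * (1 / ε ^ 2 * (1 + Real.log n) ^ e))
            (C * (1 / ε ^ 2 * (n * (1 + Real.log n) ^ e)))) := by
  refine ⟨fun q δ hδ hδ1 => ?_, 1, fun q δ hδ hδ1 => ?_⟩
  · obtain ⟨D, c, C, h⟩ := DynApproxHD.solves_of_factor (q := q) hδ hδ1 .patternOnly
    refine ⟨D, c, C, fun n m w ε hm hmn hε hε1 hw => ?_⟩
    have := h n m w ε 1 hm hmn hε hε1 hw le_rfl (by simp [DynApproxHD.addDynTime]; norm_num)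
      (by simp [DynApproxHD.readDynTime]; norm_num)
    simpa only [mul_one] using this
  · obtain ⟨D, c, C, h⟩ := DynApproxHD.solves_of_factor (q := q) hδ hδ1 .textOnly
    refine ⟨D, c, C, fun n m w ε hm hmn hε hε1 hw => ?_⟩
    have hn : 1 ≤ n := hm.trans hmn
    have hlog := DynApproxHD.natLog_le hn
    have hlog0 : 0 ≤ Real.log n := Real.log_nonneg (by exact_mod_cast hn)
    rw [pow_one]
    refine h n m w ε _ hm hmn hε hε1 hw (by linarith) ?_ ?_
    · simp only [DynApproxHD.addDynTime]
      push_cast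
      linarith
    · simp only [DynApproxHD.readDynTime]
      push_cast
      linarith
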